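/- Let $\kappa>0$ and $l\in\mathbb C$, put $p(\zeta)=\kappa|\zeta|^2+\mathrm{Re}(l\zeta^2)$ for $\zeta\in\mathbb C$, and let $$\mathcal D_{\kappa,l}=\{(z_1,z_2)\in\mathbb C^2:\ \mathrm{Im}\,z_2>p(z_1)\}.$$ For $\tau>0$ let $H_{\tau,\kappa,l}$ be the space of entire functions $f:\mathbb C\to\mathbb C$ with $\int_{\mathbb C}|f|^2e^{-4\pi\tau p}\,d\lambda<\infty$ ($\lambda$ Lebesgue measure), with inner product $\int_{\mathbb C} f\bar g\,e^{-4\pi\tau p}\,d\lambda$, and let $K_{\tau,\kappa,l}$ be its Bergman kernel, i.e. its reproducing kernel. Let $H^2(\mathcal D_{\kappa,l})$ be the Hardy space of holomorphic functions $F$ on $\mathcal D_{\kappa,l}$ with $$\sup_{\varepsilon>0}\int_{\mathbb C}\int_{\mathbb R}|F(\zeta,t+ip(\zeta)+i\varepsilon)|^2\,dt\,d\lambda(\zeta)<\infty,$$ with the inner product in $L^2(\mathbb C\times\mathbb R,\,d\lambda\,dt)$ of the boundary values (the $L^2$-limits as $\varepsilon\to0^+$ of the functions $(\zeta,t)\mapsto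 F(\zeta,t+ip(\zeta)+i\varepsilon)$), and let $S$ be the Szegő kernel of $\mathcal D_{\kappa,l}$, i.e. the reproducing kernel of $H^2(\mathcal D_{\kappa,l})$. Then these boundary values and both kernels exist, the kernels are unique, $$K_{\tau,\kappa,l}(\zeta,\omega)=4\tau\kappa\,\exp\!\big(2\pi\tau(l\zeta^2+\bar l\,\bar\omega^2)+4\pi\tau\kappa\,\zeta\bar\omega\big)\qquad(\tau>0,\ \zeta,\omega\in\mathbb C),$$ and for all $(z',z),(w',w)\in\mathcal D_{\kappa,l}$ $$S((z',z),(w',w))=\int_0^\infty K_{\tau,\kappa,l}(z',w')\,e^{-2\pi i\tau(\bar w-z)}\,d\tau =\frac{\kappa}{\pi^2}\Big(i(\bar w-z)-2\kappa z'\bar w'-\big(l z'^2+\bar l\,\bar w'^2\big)\Big)^{-2},$$ where the integral converges absolutely. (Replacing $l$ by $-l$: for the domain $\{\mathrm{Im}\,z_2>\kappa|z_1|^2-\mathrm{Re}(l z_1^2)\}$ the last term in the bracket is $+(l z'^2+\bar l\,\bar w'^2)$.) -/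

import Mathlib

open MeasureTheory Filter Topology
open scoped ComplexConjugate ENNReal Real

namespace SzegoBergman

/-! ### Weighted spaces of entire functions of one variable -/

/-- The space `A²(ℂ, e^{-φ})` of entire functions `f` with `∫ |f|² e^{-φ} dλ < ∞`. -/
def weightedSpace (φ : ℂ → ℝ) : Set (ℂ → ℂ) :=
  {f | Differentiable ℂ f ∧ Integrable (fun z : ℂ => ‖f z‖ ^ 2 * Real.exp (-φ z)) volume}

/-- `K` is the Bergman kernel of `A²(ℂ, e^{-φ})`: for each `w` the function `K(·, w)` belongs to the
space and represents the evaluation at `w` with respect to the inner product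
`⟨f, g⟩ = ∫ f ḡ e^{-φ} dλ`. -/
structure IsBergmanKernel (φ : ℂ → ℝ) (K : ℂ → ℂ → ℂ) : Prop where
  mem : ∀ w : ℂ, (fun z => K z w) ∈ weightedSpace φ
  reproducing : ∀ f ∈ weightedSpace φ, ∀ w : ℂ,
    f w = ∫ z : ℂ, f z * conj (K z w) * (Real.exp (-φ z) : ℂ)

/-! ### Hardy spaces and Szegő kernels of the domains `{Im z₂ > p(z₁)}` in `ℂ²`

The boundary is parametrised by `ℂ × ℝ` through `(ζ, t) ↦ (ζ, t + i p(ζ))` and carries the measure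
`dλ(ζ) dt`. The function `p` is meant to be continuous. -/

/-- The domain `{(z₁, z₂) ∈ ℂ² : Im z₂ > p(z₁)}`. -/
def domainAbove (p : ℂ → ℝ) : Set (ℂ × ℂ) :=
  {z | p z.1 < z.2.im}

/-- The restriction of `F` to the boundary translated by `ε` in the direction `Im z₂`:
`(ζ, t) ↦ F(ζ, t + i p(ζ) + i ε)`. -/
noncomputable def slice (p : ℂ → ℝ) (F : ℂ × ℂ → ℂ) (ε : ℝ) : ℂ × ℝ → ℂ :=
  fun q => F (q.1, (q.2 : ℂ) + Complex.I * (p q.1 : ℂ) + Complex.I * (ε : ℂ))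

/-- The Hardy space `H²`: functions `F` holomorphic in `{Im z₂ > p(z₁)}` with
`sup_{ε > 0} ∫_ℂ ∫_ℝ |F(ζ, t + i p(ζ) + i ε)|² dt dλ(ζ) < ∞`. -/
def hardySpace (p : ℂ → ℝ) : Set (ℂ × ℂ → ℂ) :=
  {F | DifferentiableOn ℂ F (domainAbove p) ∧
    (⨆ ε : Set.Ioi (0 : ℝ), ∫⁻ q : ℂ × ℝ, ‖slice p F ε q‖ₑ ^ 2) < ∞}

/-- `f ∈ L²(ℂ × ℝ)` is the boundary value of `F`: the slices of `F` tend to `f` in `L²`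
as `ε → 0+`. -/
def IsBoundaryValue (p : ℂ → ℝ) (F : ℂ × ℂ → ℂ) (f : ℂ × ℝ → ℂ) : Prop :=
  MemLp f 2 volume ∧
    Tendsto (fun ε : ℝ => eLpNorm (fun q => slice p F ε q - f q) 2 volume) (𝓝[>] 0) (𝓝 0)

/-- `S` is the Szegő kernel of `{Im z₂ > p(z₁)}`: for each `w` in the domain, `S(·, w)` belongs to
the Hardy space and represents the evaluation at `w` with respect to the inner product of boundary
values in `L²(dλ dt)` (every element of the Hardy space having such a boundary value). -/
def IsSzegoKernel (p : ℂ → ℝ) (S : ℂ × ℂ → ℂ × ℂ → ℂ) : Prop :=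
  ∀ w ∈ domainAbove p, (fun z => S z w) ∈ hardySpace p ∧
    ∃ s : ℂ × ℝ → ℂ, IsBoundaryValue p (fun z => S z w) s ∧
      ∀ F ∈ hardySpace p, ∃ f : ℂ × ℝ → ℂ, IsBoundaryValue p F f ∧
        F w = ∫ q : ℂ × ℝ, f q * conj (s q)

/-! ### The quadratic model -/

/-- The function `κ|ζ|² + Re(l ζ²)`. -/
noncomputable def quad (κ : ℝ) (l : ℂ) (ζ : ℂ) : ℝ :=
  κ * ‖ζ‖ ^ 2 + (l * ζ ^ 2).re

/-- The domain `D_{κ,l} = {Im z₂ > κ|z₁|² + Re(l z₁²)}`. -/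
noncomputable def modelDomain (κ : ℝ) (l : ℂ) : Set (ℂ × ℂ) :=
  domainAbove (quad κ l)

/-- The weight exponent `4πτ(κ|ζ|² + Re(l ζ²))` of the space `H_{τ,κ,l}`. -/
noncomputable def modelWeight (τ κ : ℝ) (l : ℂ) (ζ : ℂ) : ℝ :=
  4 * π * τ * quad κ l ζ

end SzegoBergman

namespace SzegoBergman

/-! ### Integration in polar coordinates and mean values -/

/-! Both kernels are guessed explicitly and shown to reproduce. Uniqueness then follows from
Hermitian symmetry: each kernel is evaluated by the other. No Fourier transform in `t` is used; the
integral formula is verified afterwards from the Laplace transform of `τ`.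

Bergman side: translating `w` to the origin and completing the square turns `f K̄ e^{-φ}` into an
entire function times a radial Gaussian. Averaging over circles leaves only the value at the centre
(`integral_entire_mul_gaussian`).

Boundary values: on each vertical fibre the slices of a Hardy function are related by Poisson
convolution, which is symmetric. Hence the inner product of the slices at heights `ε` and `δ` is the
squared norm of the slice at the midpoint. The squared norms are therefore midpoint convex and,
being bounded, nonincreasing, so the slices are Cauchy as `ε → 0+` (`tendsto_of_inner_shift`).

Szegő side: for fixed `ζ` the conjugate kernel has a double pole in `t` in the upper half plane, so
the `t`-integral is a derivative of `F` in its second variable (`integral_div_sq_sub`), taken at a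
height depending on `ζ`. With `a = w.1`, on the circle `|ζ - a| = r` one has `ζ̄(ζ - a) = ā(ζ - a) +
r²`, so that height agrees there with a holomorphic function of `ζ`. The mean value property moves
the derivative to `ζ = a`, at a point raised by `2κr²` (`circleAverage_deriv_szegoHeight`). The
radial integral is then that of a total derivative, and `F` vanishes at infinite height
(`tendsto_zero_of_mem_hardySpace`), so only `F(w)` shifted up by `ε` remains; finally `ε → 0`. -/

theorem integrableOn_polarCoord_target {Φ : ℂ → ℂ} (hΦ : Integrable Φ) :
    IntegrableOn (fun p : ℝ × ℝ => p.1 • Φ (Complex.polarCoord.symm p)) polarCoord.target := by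
  have h1 : Integrable (Φ ∘ Complex.measurableEquivRealProd.symm) :=
    (Complex.volume_preserving_equiv_real_prod.symm).integrable_comp_of_integrable hΦ
  have h2 : IntegrableOn (Φ ∘ Complex.measurableEquivRealProd.symm)
      (polarCoord.symm '' polarCoord.target) := h1.integrableOn
  rw [integrableOn_image_iff_integrableOn_abs_det_fderiv_smul volume
    polarCoord.open_target.measurableSet
    (fun p _ => (hasFDerivAt_polarCoord_symm p).hasFDerivWithinAt) polarCoord.symm.injOn] at h2
  refine h2.congr_fun (fun p hp => ?_) polarCoord.open_target.measurableSet
  have : 0 < p.1 := hp.1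
  simp only [det_fderivPolarCoordSymm, abs_of_pos this, Function.comp]
  rw [Complex.measurableEquivRealProd_symm_polarCoord_symm_apply]

theorem integral_Ioo_circleMap (Φ : ℂ → ℂ) (w : ℂ) (r : ℝ) :
    ∫ θ in Set.Ioo (-π) π, Φ (Complex.polarCoord.symm (r, θ) + w)
      = 2 * π * Real.circleAverage Φ w r := by
  -- The averaging interval is moved to `(-π, π)`, the angular range of the polar chart.
  have h := Real.circleAverage_eq_integral_add (f := Φ) (c := w) (R := r) (-π)
  rw [intervalIntegral.integral_comp_add_right (fun θ => Φ (circleMap w r θ))] at h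
  have e1 : (0 : ℝ) + -π = -π := by ring
  have e2 : 2 * π + -π = π := by ring
  rw [e1, e2, intervalIntegral.integral_of_le (by linarith [Real.pi_pos]),
    integral_Ioc_eq_integral_Ioo] at h
  rw [h, Complex.real_smul]
  have hpi : (π : ℂ) ≠ 0 := by exact_mod_cast Real.pi_ne_zero
  push_cast
  rw [← mul_assoc, mul_inv_cancel₀ (by simp [hpi]), one_mul]
  refine setIntegral_congr_fun measurableSet_Ioo fun θ _ => ?_
  simp only [Complex.polarCoord_symm_apply, circleMap, Complex.exp_mul_I]
  push_cast
  rw [add_comm]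

/-- Integration in polar coordinates around `w`. -/
theorem integral_eq_integral_circleAverage {Φ : ℂ → ℂ} (hΦ : Integrable Φ) (w : ℂ) :
    IntegrableOn (fun r : ℝ => (r : ℂ) * Real.circleAverage Φ w r) (Set.Ioi 0) ∧
    ∫ z, Φ z = 2 * π * ∫ r in Set.Ioi (0 : ℝ), (r : ℂ) * Real.circleAverage Φ w r := by
  have hpi : (π : ℂ) ≠ 0 := by exact_mod_cast Real.pi_ne_zero
  have hΨ : Integrable (fun z => Φ (z + w)) := hΦ.comp_add_right w
  have h := integrableOn_polarCoord_target hΨ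
  have hrw : ∀ r : ℝ, ∫ θ in Set.Ioo (-π) π, r • Φ (Complex.polarCoord.symm (r, θ) + w)
      = 2 * π * ((r : ℂ) * Real.circleAverage Φ w r) := fun r => by
    rw [integral_smul, integral_Ioo_circleMap, Complex.real_smul]; ring
  rw [IntegrableOn, polarCoord_target, Measure.volume_eq_prod, ← Measure.prod_restrict] at h
  constructor
  · have h3 := h.integral_prod_left
    simp only [hrw] at h3
    have h4 := h3.const_mul ((2 * π : ℂ)⁻¹)
    refine h4.congr (Eventually.of_forall fun r => ?_)
    simp only
    rw [← mul_assoc, inv_mul_cancel₀ (by simp [hpi]), one_mul]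
  · rw [← integral_add_right_eq_self Φ w, ← Complex.integral_comp_polarCoord_symm,
      polarCoord_target, Measure.volume_eq_prod, ← Measure.prod_restrict,
      integral_prod _ h]
    simp only [hrw]
    rw [integral_const_mul]

theorem circleAverage_eq_of_differentiableOn {g : ℂ → ℂ} {U : Set ℂ} {c : ℂ} {r : ℝ}
    (hg : DifferentiableOn ℂ g U) (hr : 0 ≤ r) (hU : Metric.closedBall c r ⊆ U) :
    Real.circleAverage g c r = g c := by
  apply DiffContOnCl.circleAverage
  rw [abs_of_nonneg hr]
  refine (hg.mono ?_).diffContOnCl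
  exact Metric.closure_ball_subset_closedBall.trans hU

/-- Area mean value property, for the square of a holomorphic function. -/
theorem sq_norm_le_lintegral_ball {g : ℂ → ℂ} {c : ℂ} {σ : ℝ} (hσ : 0 < σ)
    (hg : DifferentiableOn ℂ g (Metric.closedBall c σ)) :
    ENNReal.ofReal (π * σ ^ 2) * ‖g c‖ₑ ^ 2 ≤ ∫⁻ z in Metric.ball c σ, ‖g z‖ₑ ^ 2 := by
  -- The mean value is computed for the holomorphic `g ^ 2`, not for `‖g‖ ^ 2`; norms are taken only
  -- at the end.
  set Φ : ℂ → ℂ := (Metric.ball c σ).indicator (fun z => g z ^ 2) with hΦdef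
  have hcont : ContinuousOn (fun z => g z ^ 2) (Metric.closedBall c σ) := hg.continuousOn.pow 2
  have hion : IntegrableOn (fun z => g z ^ 2) (Metric.ball c σ) :=
    (hcont.integrableOn_compact (isCompact_closedBall c σ)).mono_set Metric.ball_subset_closedBall
  have hΦ : Integrable Φ := hion.integrable_indicator measurableSet_ball
  have hca : ∀ r ∈ Set.Ioi (0 : ℝ), (r : ℂ) * Real.circleAverage Φ c r
      = (Set.Iio σ).indicator (fun r : ℝ => (r : ℂ) * g c ^ 2) r := by
    intro r hr
    rcases lt_or_ge r σ with h | h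
    · rw [Set.indicator_of_mem (by exact h)]
      congr 1
      refine Eq.trans ?_ (circleAverage_eq_of_differentiableOn (hg.pow 2) (le_of_lt hr)
        (Metric.closedBall_subset_closedBall h.le))
      refine Real.circleAverage_congr_sphere fun z hz => ?_
      rw [abs_of_pos hr, mem_sphere_iff_norm] at hz
      rw [hΦdef, Set.indicator_of_mem]
      · rfl
      · rw [mem_ball_iff_norm, hz]; exact h
    · rw [Set.indicator_of_notMem (by simpa using h)]
      have : Real.circleAverage Φ c r = Real.circleAverage (fun _ => (0 : ℂ)) c r := by
        refine Real.circleAverage_congr_sphere fun z hz => ?_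
        rw [abs_of_pos hr, mem_sphere_iff_norm] at hz
        rw [hΦdef, Set.indicator_of_notMem]
        rw [mem_ball_iff_norm, hz]; exact not_lt.2 h
      rw [this, Real.circleAverage_const, mul_zero]
  have hI : ∫ z, Φ z = (π * σ ^ 2 : ℝ) * g c ^ 2 := by
    rw [(integral_eq_integral_circleAverage hΦ c).2, setIntegral_congr_fun measurableSet_Ioi hca,
      setIntegral_indicator measurableSet_Iio, Set.Ioi_inter_Iio, integral_mul_const,
      ← integral_Ioc_eq_integral_Ioo, ← intervalIntegral.integral_of_le hσ.le,
      intervalIntegral.integral_ofReal, integral_id]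
    push_cast; ring
  have hle : ‖∫ z, Φ z‖ₑ ≤ ∫⁻ z, ‖Φ z‖ₑ := enorm_integral_le_lintegral_enorm _
  rw [hI, enorm_mul, enorm_pow, ← ofReal_norm (((π * σ ^ 2 : ℝ)) : ℂ), Complex.norm_real,
    Real.norm_of_nonneg (by positivity)] at hle
  refine hle.trans (le_of_eq ?_)
  rw [hΦdef, ← lintegral_indicator measurableSet_ball]
  refine lintegral_congr fun z => ?_
  rw [enorm_indicator_eq_indicator_enorm]
  simp [Set.indicator, enorm_pow]

/-! ### The Fock space -/

theorem integrable_exp_neg_mul_sq_norm {b : ℝ} (hb : 0 < b) :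
    Integrable (fun z : ℂ => Real.exp (-b * ‖z‖ ^ 2)) := by
  have h := GaussianFourier.integrable_cexp_neg_mul_sq_norm_add (V := ℂ) (b := (b : ℂ))
    (by simpa using hb) 0 0
  refine h.norm.congr (Eventually.of_forall fun z => ?_)
  simp only [Complex.norm_exp]
  congr 1
  simp [← Complex.ofReal_pow]

theorem circleAverage_mul_radial {g : ℂ → ℂ} (hg : Differentiable ℂ g) (χ : ℝ → ℂ) {r : ℝ}
    (hr : 0 ≤ r) : Real.circleAverage (fun z => g z * χ ‖z‖) 0 r = g 0 * χ r := by
  have h1 : Real.circleAverage (fun z => g z * χ ‖z‖) 0 r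
      = Real.circleAverage (fun z => g z * χ r) 0 r := by
    refine Real.circleAverage_congr_sphere fun z hz => ?_
    rw [abs_of_nonneg hr, mem_sphere_zero_iff_norm] at hz
    simp only [hz]
  rw [h1]
  exact circleAverage_eq_of_differentiableOn (U := Set.univ)
    (by fun_prop : Differentiable ℂ fun z => g z * χ r).differentiableOn hr (Set.subset_univ _)

/-- Circle averages replace `g` by `g 0`, and the remaining radial integral is `2π ∫ r e^{-αr²} dr =
π / α`. -/
theorem integral_entire_mul_gaussian {α : ℝ} (hα : 0 < α) {g : ℂ → ℂ} (hg : Differentiable ℂ g)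
    (hi : Integrable (fun z : ℂ => g z * (Real.exp (-α * ‖z‖ ^ 2) : ℂ))) :
    ∫ z : ℂ, g z * (Real.exp (-α * ‖z‖ ^ 2) : ℂ) = π / α * g 0 := by
  have hca : ∀ {h : ℂ → ℂ}, Differentiable ℂ h → ∀ r ∈ Set.Ioi (0 : ℝ), (r : ℂ) *
      Real.circleAverage (fun z => h z * (Real.exp (-α * ‖z‖ ^ 2) : ℂ)) 0 r
      = ((r : ℂ) * Complex.exp (-α * r ^ 2)) * h 0 := by
    intro h hh r hr
    have := circleAverage_mul_radial hh (fun r => (Real.exp (-α * r ^ 2) : ℂ)) (le_of_lt hr)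
    rw [this]; push_cast; ring
  have hα' : (α : ℂ) ≠ 0 := by exact_mod_cast hα.ne'
  rw [(integral_eq_integral_circleAverage hi 0).2, setIntegral_congr_fun measurableSet_Ioi (hca hg),
    integral_mul_const, integral_mul_cexp_neg_mul_sq (by simpa using hα)]
  field_simp

/-! ### The Bergman kernel of the model weight -/

/-- The explicit Bergman kernel of the model weight. -/
noncomputable def modelBergman (κ : ℝ) (l : ℂ) (τ : ℝ) (z w : ℂ) : ℂ :=
  4 * τ * κ * Complex.exp
    (2 * π * τ * (l * z ^ 2 + conj l * conj w ^ 2) + 4 * π * τ * κ * z * conj w)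

theorem ofReal_quad (κ : ℝ) (l z : ℂ) : (quad κ l z : ℂ) =
    κ * (z * conj z) + (l * z ^ 2 + conj l * conj z ^ 2) / 2 := by
  rw [quad, Complex.ofReal_add, Complex.re_eq_add_conj, Complex.mul_conj, Complex.normSq_eq_norm_sq]
  simp

theorem conj_modelBergman (κ : ℝ) (l : ℂ) (τ : ℝ) (z w : ℂ) :
    conj (modelBergman κ l τ z w) = modelBergman κ l τ w z := by
  simp only [modelBergman, map_mul, map_add, map_pow, Complex.conj_conj, ← Complex.exp_conj,
    Complex.conj_ofReal, map_ofNat]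
  ring_nf

/-- Completing the square gives a Gaussian centred at `w`, which makes membership in the weighted
space immediate. -/
theorem ofReal_norm_sq_modelBergman_mul_exp (κ : ℝ) (l : ℂ) (τ : ℝ) (z w : ℂ) :
    ‖modelBergman κ l τ z w‖ ^ 2 * Real.exp (-modelWeight τ κ l z) =
      ((4 * τ * κ) ^ 2 * Real.exp (modelWeight τ κ l w)) *
        Real.exp (-(4 * π * τ * κ) * ‖z - w‖ ^ 2) := by
  have h : ∀ u : ℂ, ((‖u‖ ^ 2 : ℝ) : ℂ) = u * conj u := fun u => by
    rw [Complex.mul_conj, Complex.normSq_eq_norm_sq]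
  apply Complex.ofReal_injective
  rw [Complex.ofReal_mul, h, conj_modelBergman, Complex.ofReal_mul, Complex.ofReal_mul,
    Complex.ofReal_exp, Complex.ofReal_exp, Complex.ofReal_exp, Complex.ofReal_mul, h,
    Complex.ofReal_neg]
  simp only [modelBergman, modelWeight, Complex.ofReal_mul, ofReal_quad]
  have e : ∀ a b c A B C D E : ℂ, a * b = c → A + B + C = D + E → a * Complex.exp A *
      (b * Complex.exp B) * Complex.exp C = c * Complex.exp D * Complex.exp E := by
    intro a b c A B C D E h1 hh
    rw [mul_assoc c, ← Complex.exp_add, ← hh, ← h1, Complex.exp_add, Complex.exp_add]; ring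
  apply e
  · push_cast; ring
  · push_cast
    simp only [map_sub]
    ring

theorem modelBergman_mem {κ : ℝ} (hκ : 0 < κ) (l : ℂ) {τ : ℝ} (hτ : 0 < τ) (w : ℂ) :
    (fun z => modelBergman κ l τ z w) ∈ weightedSpace (modelWeight τ κ l) := by
  constructor
  · unfold modelBergman; fun_prop
  · simp only [ofReal_norm_sq_modelBergman_mul_exp]
    exact ((integrable_exp_neg_mul_sq_norm (by positivity : 0 < 4 * π * τ * κ)).comp_sub_right
      w).const_mul _

theorem continuous_quad (κ : ℝ) (l : ℂ) : Continuous (quad κ l) := by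
  unfold quad; fun_prop

theorem integrable_mul_conj_of_mem_weightedSpace {φ : ℂ → ℝ} (hφ : Continuous φ) {f g : ℂ → ℂ}
    (hf : f ∈ weightedSpace φ) (hg : g ∈ weightedSpace φ) :
    Integrable (fun z : ℂ => f z * conj (g z) * (Real.exp (-φ z) : ℂ)) := by
  refine (hf.2.add hg.2).mono' ?_ (Eventually.of_forall fun z => ?_)
  · have h1 := hf.1.continuous
    have h2 := hg.1.continuous
    have : Continuous (fun z : ℂ => f z * conj (g z) * (Real.exp (-φ z) : ℂ)) := by fun_prop
    exact this.aestronglyMeasurable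
  · simp only [norm_mul, RCLike.norm_conj, Complex.norm_real, Pi.add_apply,
      Real.norm_of_nonneg (Real.exp_pos _).le, ← add_mul]
    gcongr
    nlinarith [sq_nonneg (‖f z‖ - ‖g z‖), sq_nonneg (‖f z‖), sq_nonneg ‖g z‖]

theorem isBergmanKernel_modelBergman {κ : ℝ} (hκ : 0 < κ) (l : ℂ) {τ : ℝ} (hτ : 0 < τ) :
    IsBergmanKernel (modelWeight τ κ l) (modelBergman κ l τ) := by
  refine ⟨modelBergman_mem hκ l hτ, fun f hf w => ?_⟩
  have hφ : Continuous (modelWeight τ κ l) := continuous_const.mul (continuous_quad κ l)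
  have hi := integrable_mul_conj_of_mem_weightedSpace hφ hf (modelBergman_mem hκ l hτ w)
  set α : ℝ := 4 * π * τ * κ with hα
  have hα0 : 0 < α := by positivity
  -- The entire factor left after the Gaussian is split off. Here `α / π = 4τκ` is the prefactor of
  -- the kernel, and the exponential equals `1` at `z = 0`.
  set G : ℂ → ℂ := fun z => (α / π) * (f (z + w) *
    Complex.exp (2 * π * τ * l * (w ^ 2 - (z + w) ^ 2) - 4 * π * τ * κ * conj w * z)) with hG
  have hpi : (π : ℂ) ≠ 0 := by exact_mod_cast Real.pi_ne_zero
  have hα' : (α : ℂ) ≠ 0 := by exact_mod_cast hα0.ne'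
  have key : ∀ z : ℂ, f (z + w) * conj (modelBergman κ l τ (z + w) w) *
      (Real.exp (-modelWeight τ κ l (z + w)) : ℂ) = G z * (Real.exp (-α * ‖z‖ ^ 2) : ℂ) := by
    intro z
    have h : ((‖z‖ : ℂ) ^ 2) = z * conj z := by
      rw [Complex.mul_conj, Complex.normSq_eq_norm_sq]; norm_cast
    have e : ∀ a b c A B C D : ℂ, a * b = c * a → A + B = C + D → a * (b * Complex.exp A) *
        Complex.exp B = c * (a * Complex.exp C) * Complex.exp D := by
      intro a b c A B C D h1 hh
      rw [← mul_assoc a, mul_assoc (a * b), ← Complex.exp_add, hh, h1, Complex.exp_add]; ring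
    rw [conj_modelBergman, Complex.ofReal_exp, Complex.ofReal_exp]
    simp only [hG, modelBergman, modelWeight, Complex.ofReal_mul, Complex.ofReal_neg, ofReal_quad]
    push_cast
    rw [h]
    apply e
    · rw [hα]; push_cast; field_simp
    · rw [hα]; push_cast; simp only [map_add]; ring
  have hGd : Differentiable ℂ G := by
    have := hf.1
    fun_prop
  have hi2 := hi.comp_add_right w
  simp only [key] at hi2
  rw [← integral_add_right_eq_self _ w]
  simp only [key]
  rw [integral_entire_mul_gaussian hα0 hGd hi2, hG]
  simp only [zero_add, sub_self, mul_zero, Complex.exp_zero, mul_one]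
  field_simp

/-- Uniqueness of the Bergman kernel, given one with Hermitian symmetry. -/
theorem IsBergmanKernel.eq {φ : ℂ → ℝ} {K K' : ℂ → ℂ → ℂ} (hK : IsBergmanKernel φ K)
    (hK' : IsBergmanKernel φ K') (hsymm : ∀ z w, conj (K' z w) = K' w z) (z w : ℂ) :
    K z w = K' z w := by
  rw [hK'.reproducing _ (hK.mem w) z, ← hsymm w z, hK.reproducing _ (hK'.mem z) w, ← integral_conj]
  congr 1 with u
  simp only [map_mul, Complex.conj_conj, Complex.conj_ofReal]
  ring

/-! ### The Cauchy theorem and integral formulas in the upper half plane -/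

theorem exists_norm_le_div_one_add_sq {g : ℂ → ℂ} {R C : ℝ}
    (hg : ContinuousOn g {z | 0 ≤ z.im})
    (hC : ∀ z : ℂ, 0 ≤ z.im → R ≤ ‖z‖ → ‖g z‖ ≤ C / ‖z‖ ^ 2) :
    ∃ C', 0 ≤ C' ∧ ∀ z : ℂ, 0 ≤ z.im → ‖g z‖ ≤ C' * (1 + ‖z‖ ^ 2)⁻¹ := by
  have hclosed : IsClosed {z : ℂ | 0 ≤ z.im} := isClosed_le continuous_const Complex.continuous_im
  have hK : IsCompact (Metric.closedBall (0 : ℂ) (max R 1) ∩ {z | 0 ≤ z.im}) :=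
    (isCompact_closedBall _ _).inter_right hclosed
  obtain ⟨B, hB⟩ := hK.exists_bound_of_continuousOn (hg.mono Set.inter_subset_right)
  refine ⟨max (2 * |C|) (|B| * (1 + (max R 1) ^ 2)), by positivity, fun z hz => ?_⟩
  rw [← div_eq_mul_inv, le_div_iff₀ (by positivity)]
  rcases le_total ‖z‖ (max R 1) with h | h
  · refine le_trans ?_ (le_max_right _ _)
    have := (hB z ⟨by simpa using h, hz⟩).trans (le_abs_self B)
    gcongr
  · refine le_trans ?_ (le_max_left _ _)
    have h1 : 1 ≤ ‖z‖ := (le_max_right _ _).trans h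
    have h2 := hC z hz ((le_max_left _ _).trans h)
    have h3 : ‖g z‖ * ‖z‖ ^ 2 ≤ |C| := by
      rw [le_div_iff₀ (by positivity)] at h2
      exact h2.trans (le_abs_self C)
    nlinarith [norm_nonneg (g z), mul_nonneg (norm_nonneg (g z)) (by nlinarith : 0 ≤ ‖z‖ ^ 2 - 1)]

theorem integral_eq_zero_of_holomorphic_upper {g : ℂ → ℂ} {R C : ℝ}
    (hg : ∀ z : ℂ, 0 ≤ z.im → DifferentiableAt ℂ g z)
    (hC : ∀ z : ℂ, 0 ≤ z.im → R ≤ ‖z‖ → ‖g z‖ ≤ C / ‖z‖ ^ 2) :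
    Integrable (fun t : ℝ => g t) ∧ ∫ t : ℝ, g t = 0 := by
  have hcont : ContinuousOn g {z | 0 ≤ z.im} :=
    fun z hz => (hg z hz).continuousAt.continuousWithinAt
  obtain ⟨C', hC0, hC'⟩ := exists_norm_le_div_one_add_sq hcont hC
  have hcr : Continuous (fun t : ℝ => g t) :=
    hcont.comp_continuous Complex.continuous_ofReal (fun t => by simp)
  have hint : Integrable (fun t : ℝ => g t) := by
    refine (integrable_inv_one_add_sq.const_mul C').mono' hcr.aestronglyMeasurable
      (Eventually.of_forall fun t => ?_)
    simpa using hC' t (by simp)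
  refine ⟨hint, ?_⟩
  have hbd : ∀ r : ℝ, 0 < r → ∀ z : ℂ, 0 ≤ z.im → r ≤ ‖z‖ → ‖g z‖ ≤ C' / r ^ 2 := by
    intro r hr z hz hrz
    refine (hC' z hz).trans ?_
    rw [div_eq_mul_inv]
    gcongr
    nlinarith
  have hbound : ∀ r : ℝ, 0 < r → ‖∫ x in (-r)..r, g (x : ℂ)‖ ≤ 4 * C' / r := by
    intro r hr
    -- Rectangle `[-r, r] × [0, r]`: the three sides off the real axis have total length `4r` and
    -- the integrand there is at most `C' / r²`.
    have hrect := Complex.integral_boundary_rect_eq_zero_of_differentiableOn g (-r : ℂ)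
      (r + r * Complex.I) (fun z hz => by
        refine (hg z ?_).differentiableWithinAt
        have := hz.2
        simp [Set.uIcc_of_le hr.le] at this
        exact this.1)
    simp only [Complex.neg_re, Complex.ofReal_re, Complex.add_re, Complex.mul_re, Complex.I_re,
      mul_zero, Complex.ofReal_im, Complex.I_im, mul_one, sub_self, add_zero, Complex.neg_im,
      Complex.add_im, Complex.mul_im, zero_add, neg_zero, Complex.ofReal_zero, zero_mul,
      smul_eq_mul] at hrect
    have hre : ∀ z : ℂ, r ≤ |z.re| → r ≤ ‖z‖ := fun z h => h.trans (Complex.abs_re_le_norm z)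
    have him : ∀ z : ℂ, r ≤ |z.im| → r ≤ ‖z‖ := fun z h => h.trans (Complex.abs_im_le_norm z)
    have h1 : ‖∫ x in (-r)..r, g (x + r * Complex.I)‖ ≤ C' / r ^ 2 * |r - -r| := by
      refine intervalIntegral.norm_integral_le_of_norm_le_const fun x _ => ?_
      refine hbd r hr _ (by simp [hr.le]) (him _ (by simp [abs_of_pos hr]))
    have h2 : ‖∫ y in (0 : ℝ)..r, g ((r : ℂ) + y * Complex.I)‖ ≤ C' / r ^ 2 * |r - 0| := by
      refine intervalIntegral.norm_integral_le_of_norm_le_const fun y hy => ?_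
      rw [Set.uIoc_of_le hr.le] at hy
      refine hbd r hr _ (by simp [hy.1.le]) (hre _ (by simp [abs_of_pos hr]))
    have h3 : ‖∫ y in (0 : ℝ)..r, g (((-r : ℝ) : ℂ) + y * Complex.I)‖ ≤ C' / r ^ 2 * |r - 0| := by
      refine intervalIntegral.norm_integral_le_of_norm_le_const fun y hy => ?_
      rw [Set.uIoc_of_le hr.le] at hy
      refine hbd r hr _ (by simp [hy.1.le]) (hre _ (by simp [abs_of_pos hr]))
    have e1 : |r - -r| = 2 * r := by rw [abs_of_pos] <;> linarith
    have e2 : |r - 0| = r := by rw [sub_zero, abs_of_pos hr]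
    rw [e1] at h1
    rw [e2] at h2 h3
    have key : (∫ x in (-r)..r, g (x : ℂ)) = (∫ x in (-r)..r, g (x + r * Complex.I))
        - Complex.I * (∫ y in (0 : ℝ)..r, g ((r : ℂ) + y * Complex.I))
        + Complex.I * (∫ y in (0 : ℝ)..r, g (((-r : ℝ) : ℂ) + y * Complex.I)) := by
      linear_combination hrect
    rw [key]
    refine (norm_add_le _ _).trans ((add_le_add_left (norm_sub_le _ _) _).trans ?_)
    rw [norm_mul, norm_mul, Complex.norm_I, one_mul, one_mul]
    have : C' / r ^ 2 * (2 * r) + C' / r ^ 2 * r + C' / r ^ 2 * r = 4 * C' / r := by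
      field_simp; ring
    linarith
  have hlim := intervalIntegral_tendsto_integral hint tendsto_neg_atTop_atBot tendsto_id
  have hlim0 : Tendsto (fun r : ℝ => ∫ x in (-r)..(id r), g (x : ℂ)) atTop (𝓝 0) := by
    refine squeeze_zero_norm' ((eventually_gt_atTop 0).mono fun r hr => hbound r hr) ?_
    exact tendsto_const_nhds.div_atTop tendsto_id
  exact tendsto_nhds_unique hlim hlim0

theorem norm_half_le_norm_sub {z c : ℂ} (h : 2 * ‖c‖ ≤ ‖z‖) : ‖z‖ / 2 ≤ ‖z - c‖ := by
  have := norm_sub_norm_le z c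
  linarith

/-- The Poisson kernel of the upper half plane. -/
noncomputable def poisson (η u : ℝ) : ℝ := η / (π * (u ^ 2 + η ^ 2))

theorem poisson_nonneg {η : ℝ} (hη : 0 < η) (u : ℝ) : 0 ≤ poisson η u := by
  unfold poisson; positivity

theorem continuous_poisson {η : ℝ} (hη : 0 < η) : Continuous (poisson η) := by
  unfold poisson
  refine continuous_const.div (by fun_prop) fun u => ?_
  positivity

theorem poisson_neg (η u : ℝ) : poisson η (-u) = poisson η u := by
  simp [poisson]

theorem poisson_eq {η : ℝ} (hη : 0 < η) (u : ℝ) :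
    poisson η u = (π⁻¹ * η⁻¹) * (1 + (u / η) ^ 2)⁻¹ := by
  unfold poisson
  field_simp
  ring

theorem integrable_poisson {η : ℝ} (hη : 0 < η) : Integrable (poisson η) := by
  have := (integrable_inv_one_add_sq.comp_div hη.ne').const_mul (π⁻¹ * η⁻¹)
  exact this.congr (Eventually.of_forall fun u => (poisson_eq hη u).symm)

theorem integral_poisson {η : ℝ} (hη : 0 < η) : ∫ u, poisson η u = 1 := by
  simp only [poisson_eq hη]
  rw [integral_const_mul, Measure.integral_comp_div (fun x : ℝ => (1 + x ^ 2)⁻¹),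
    integral_univ_inv_one_add_sq, abs_of_pos hη, smul_eq_mul]
  field_simp

/-- Turns a product of simple poles at `c` and `c̄` into a Poisson kernel, whose integral is known;
this replaces residue calculus. -/
theorem sub_mul_sub_conj_eq {c : ℂ} (hc : 0 < c.im) (t : ℝ) :
    ((t - c) * (t - conj c))⁻¹ = (π / c.im : ℂ) * (poisson c.im (c.re - t) : ℂ) := by
  have h : ((t : ℂ) - c) * (t - conj c) = (((c.re - t) ^ 2 + c.im ^ 2 : ℝ) : ℂ) := by
    rw [sq, sq]
    apply Complex.ext
    · simp; ring
    · simp; ring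
  have h0 : (c.re - t) ^ 2 + c.im ^ 2 ≠ 0 := by positivity
  rw [h, poisson]
  have := hc.ne'
  have := Real.pi_ne_zero
  norm_cast
  field_simp

theorem im_sub_conj_ne {c z : ℂ} (hz : -c.im < z.im) : z - conj c ≠ 0 := by
  intro h
  have := congrArg Complex.im h
  simp at this
  linarith

theorem poisson_integral {f : ℂ → ℂ} {δ M : ℝ} (hδ : 0 < δ)
    (hf : DifferentiableOn ℂ f {z | -δ < z.im}) (hM : ∀ z : ℂ, 0 ≤ z.im → ‖f z‖ ≤ M)
    {η : ℝ} (hη : 0 < η) (x : ℝ) :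
    ∫ t : ℝ, (poisson η (x - t) : ℂ) * f t = f (x + η * Complex.I) := by
  set c : ℂ := x + η * Complex.I with hc
  have hcim : c.im = η := by simp [hc]
  have hcre : c.re = x := by simp [hc]
  have hci : 0 < c.im := by rw [hcim]; exact hη
  set U : Set ℂ := {z | -δ < z.im} with hU
  have hUo : IsOpen U := isOpen_lt continuous_const Complex.continuous_im
  have hcU : c ∈ U := by simp only [hU, Set.mem_ofPred_eq]; linarith
  have hd := (Complex.differentiableOn_dslope (hUo.mem_nhds hcU)).2 hf
  -- Subtracting `f c` removes the pole at `c`; the pole at `c̄` lies below the axis. As `f` is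
  -- bounded, `g` is `O(‖z‖⁻²)` and integrates to zero.
  set g : ℂ → ℂ := fun z => dslope f c z / (z - conj c) with hg
  have hgd : ∀ z : ℂ, 0 ≤ z.im → DifferentiableAt ℂ g z := by
    intro z hz
    have hzU : z ∈ U := by simp only [hU, Set.mem_ofPred_eq]; linarith
    refine (hd.differentiableAt (hUo.mem_nhds hzU)).div (by fun_prop) ?_
    exact im_sub_conj_ne (by linarith)
  have hgeq : ∀ z : ℂ, z ≠ c → g z = (f z - f c) * ((z - c) * (z - conj c))⁻¹ := by
    intro z hz
    rw [hg]
    simp only [dslope_of_ne _ hz, slope_def_field]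
    rw [mul_inv, div_eq_mul_inv, div_eq_mul_inv, mul_assoc]
  have hgC : ∀ z : ℂ, 0 ≤ z.im → 2 * ‖c‖ + 1 ≤ ‖z‖ → ‖g z‖ ≤ 8 * M / ‖z‖ ^ 2 := by
    intro z hz hzc
    have hc0 := norm_nonneg c
    have hz0 : 0 < ‖z‖ := by linarith
    have hne : z ≠ c := by rintro rfl; linarith
    have h1 : ‖z‖ / 2 ≤ ‖z - c‖ := norm_half_le_norm_sub (by linarith)
    have h2 : ‖z‖ / 2 ≤ ‖z - conj c‖ := norm_half_le_norm_sub (by rw [RCLike.norm_conj]; linarith)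
    have hM0 : 0 ≤ M := (norm_nonneg _).trans (hM z hz)
    rw [hgeq z hne, norm_mul, norm_inv, norm_mul]
    calc ‖f z - f c‖ * (‖z - c‖ * ‖z - conj c‖)⁻¹ ≤ (M + M) * (‖z‖ / 2 * (‖z‖ / 2))⁻¹ := by
          gcongr
          exact (norm_sub_le _ _).trans (add_le_add (hM z hz) (hM c hci.le))
      _ = 8 * M / ‖z‖ ^ 2 := by field_simp; ring
  obtain ⟨hgi, hg0⟩ := integral_eq_zero_of_holomorphic_upper hgd hgC
  have hp : Integrable (fun t : ℝ => (poisson η (x - t) : ℂ)) :=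
    ((integrable_poisson hη).comp_sub_left x).ofReal
  have heq : ∀ t : ℝ, (poisson η (x - t) : ℂ) * f t
      = (η / π : ℂ) * g t + (poisson η (x - t) : ℂ) * f c := by
    intro t
    have hne : (t : ℂ) ≠ c := fun h => by
      have := congrArg Complex.im h
      simp [hcim] at this
      linarith
    rw [hgeq _ hne, sub_mul_sub_conj_eq hci, hcim, hcre]
    have h1 : (η : ℂ) ≠ 0 := by exact_mod_cast hη.ne'
    have h2 : (π : ℂ) ≠ 0 := by exact_mod_cast Real.pi_ne_zero
    field_simp
    ring
  simp only [heq]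
  rw [integral_add (hgi.const_mul _) (hp.mul_const _), integral_const_mul, hg0,
    integral_mul_const, integral_complex_ofReal, integral_sub_left_eq_self (poisson η) volume x,
    integral_poisson hη]
  simp

/-- For real `t`, conjugation moves the pole to `c̄`, outside the upper half plane, where the Cauchy
theorem applies. -/
theorem integral_inv_sq_sub {c : ℂ} (hc : 0 < c.im) :
    Integrable (fun t : ℝ => ((t - c) ^ 2)⁻¹) ∧ ∫ t : ℝ, (((t : ℂ) - c) ^ 2)⁻¹ = 0 := by
  have h := integral_eq_zero_of_holomorphic_upper (g := fun z => ((z - conj c) ^ 2)⁻¹)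
    (R := 2 * ‖c‖ + 1) (C := 4) (fun z hz => by
      have := im_sub_conj_ne (by linarith : -c.im < z.im)
      exact DifferentiableAt.fun_inv (by fun_prop) (pow_ne_zero 2 this)) (fun z hz hzc => by
      have hc0 := norm_nonneg c
      have hz0 : 0 < ‖z‖ := by linarith
      have h2 : ‖z‖ / 2 ≤ ‖z - conj c‖ := norm_half_le_norm_sub (by rw [RCLike.norm_conj]; linarith)
      rw [norm_inv, norm_pow]
      calc (‖z - conj c‖ ^ 2)⁻¹ ≤ ((‖z‖ / 2) ^ 2)⁻¹ := by gcongr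
        _ = 4 / ‖z‖ ^ 2 := by field_simp; norm_num)
  have e : ∀ t : ℝ, conj ((((t : ℂ) - conj c) ^ 2)⁻¹) = (((t : ℂ) - c) ^ 2)⁻¹ := fun t => by
    simp
  constructor
  · have := (Complex.conjCLE : ℂ →L[ℝ] ℂ).integrable_comp h.1
    refine this.congr (Eventually.of_forall fun t => ?_)
    exact e t
  · simp only [← e]
    rw [integral_conj, h.2, map_zero]

theorem integral_div_sq_sub {f : ℂ → ℂ} {δ M : ℝ} (hδ : 0 < δ)
    (hf : DifferentiableOn ℂ f {z | -δ < z.im}) (hM : ∀ z : ℂ, 0 ≤ z.im → ‖f z‖ ≤ M)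
    {c : ℂ} (hci : 0 < c.im) :
    ∫ t : ℝ, f t * (((t : ℂ) - c) ^ 2)⁻¹ = 2 * π * Complex.I * deriv f c := by
  set U : Set ℂ := {z | -(min δ c.im) < z.im} with hU
  have hUo : IsOpen U := isOpen_lt continuous_const Complex.continuous_im
  have hm : 0 < min δ c.im := lt_min hδ hci
  have hpos : ∀ z : ℂ, 0 ≤ z.im → z ∈ U := fun z hz => by
    simp only [hU, Set.mem_ofPred_eq]; linarith
  have hcU : c ∈ U := hpos c hci.le
  have hcc : c - conj c ≠ 0 := im_sub_conj_ne (by linarith)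
  have hne : ∀ z ∈ U, z - conj c ≠ 0 := fun z hz => im_sub_conj_ne (by
    have h1 : -(min δ c.im) < z.im := hz
    have := min_le_right δ c.im
    linarith)
  have hfU : DifferentiableOn ℂ f U := hf.mono fun z hz => by
    have h1 : -(min δ c.im) < z.im := hz
    have := min_le_left δ c.im
    simp only [Set.mem_ofPred_eq]; linarith
  set β : ℂ := deriv f c * (c - conj c) with hβ
  -- The correction makes `k` vanish to second order at `c`. The Blaschke factor replaces `z - c`
  -- because it stays bounded on the half plane, so `k / (z - c)²` still decays quadratically.
  set k : ℂ → ℂ := fun z => f z - f c - β * ((z - c) / (z - conj c)) with hk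
  have hkd : DifferentiableOn ℂ k U := by
    refine (hfU.sub_const _).sub (DifferentiableOn.const_mul ?_ β)
    exact DifferentiableOn.fun_div (by fun_prop) (by fun_prop) hne
  have hk0 : k c = 0 := by simp [hk]
  have hk1 : HasDerivAt k 0 c := by
    have h1 : HasDerivAt f (deriv f c) c := (hfU.differentiableAt (hUo.mem_nhds hcU)).hasDerivAt
    have h2 : HasDerivAt (fun z => (z - c) / (z - conj c))
        ((1 * (c - conj c) - (c - c) * 1) / (c - conj c) ^ 2) c :=
      ((hasDerivAt_id c).sub_const c).fun_div ((hasDerivAt_id c).sub_const _) hcc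
    refine ((h1.sub_const (f c)).sub (h2.const_mul β)).congr_deriv ?_
    rw [hβ]
    field_simp
    ring
  have hd1 := (Complex.differentiableOn_dslope (hUo.mem_nhds hcU)).2 hkd
  have hd2 := (Complex.differentiableOn_dslope (hUo.mem_nhds hcU)).2 hd1
  set g : ℂ → ℂ := dslope (dslope k c) c with hg
  have hgd : ∀ z : ℂ, 0 ≤ z.im → DifferentiableAt ℂ g z := fun z hz =>
    hd2.differentiableAt (hUo.mem_nhds (hpos z hz))
  have hgeq : ∀ z : ℂ, z ≠ c → g z = k z * ((z - c) ^ 2)⁻¹ := by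
    intro z hz
    rw [hg, dslope_of_ne _ hz, slope_def_field, dslope_same, hk1.deriv, dslope_of_ne _ hz,
      slope_def_field, hk0]
    have : z - c ≠ 0 := sub_ne_zero.2 hz
    field_simp
    ring
  have hkM : ∀ z : ℂ, 0 ≤ z.im → ‖k z‖ ≤ M + M + ‖β‖ := by
    intro z hz
    have h1 : ‖(z - c) / (z - conj c)‖ ≤ 1 := by
      rw [norm_div]
      refine div_le_one_of_le₀ ?_ (norm_nonneg _)
      rw [← sq_le_sq₀ (norm_nonneg _) (norm_nonneg _), ← Complex.normSq_eq_norm_sq,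
        ← Complex.normSq_eq_norm_sq, Complex.normSq_apply, Complex.normSq_apply]
      simp
      nlinarith
    refine (norm_sub_le _ _).trans (add_le_add ((norm_sub_le _ _).trans
      (add_le_add (hM z hz) (hM c hci.le))) ?_)
    rw [norm_mul]
    exact mul_le_of_le_one_right (norm_nonneg _) h1
  have hgC : ∀ z : ℂ, 0 ≤ z.im → 2 * ‖c‖ + 1 ≤ ‖z‖ →
      ‖g z‖ ≤ 4 * (M + M + ‖β‖) / ‖z‖ ^ 2 := by
    intro z hz hzc
    have hc0 := norm_nonneg c
    have hz0 : 0 < ‖z‖ := by linarith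
    have hne : z ≠ c := by rintro rfl; linarith
    have h1 : ‖z‖ / 2 ≤ ‖z - c‖ := norm_half_le_norm_sub (by linarith)
    have hM0 : 0 ≤ M := (norm_nonneg _).trans (hM z hz)
    rw [hgeq z hne, norm_mul, norm_inv, norm_pow]
    calc ‖k z‖ * (‖z - c‖ ^ 2)⁻¹ ≤ (M + M + ‖β‖) * ((‖z‖ / 2) ^ 2)⁻¹ := by
          gcongr
          exact hkM z hz
      _ = 4 * (M + M + ‖β‖) / ‖z‖ ^ 2 := by field_simp; norm_num
  obtain ⟨hgi, hg0⟩ := integral_eq_zero_of_holomorphic_upper hgd hgC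
  obtain ⟨hsi, hs0⟩ := integral_inv_sq_sub hci
  have hp : Integrable (fun t : ℝ => (poisson c.im (c.re - t) : ℂ)) :=
    ((integrable_poisson hci).comp_sub_left c.re).ofReal
  have heq : ∀ t : ℝ, f t * (((t : ℂ) - c) ^ 2)⁻¹ = g t + f c * (((t : ℂ) - c) ^ 2)⁻¹ +
      β * (π / c.im : ℂ) * (poisson c.im (c.re - t) : ℂ) := by
    intro t
    have htc : (t : ℂ) ≠ c := fun h => by
      have := congrArg Complex.im h
      simp at this
      linarith
    rw [hgeq _ htc, mul_assoc β, ← sub_mul_sub_conj_eq hci, hk]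
    have h1 : (t : ℂ) - c ≠ 0 := sub_ne_zero.2 htc
    have h2 : (t : ℂ) - conj c ≠ 0 := hne t (hpos t (by simp))
    field_simp
    ring
  simp only [heq]
  have hgs : Integrable (fun t : ℝ => g t + f c * (((t : ℂ) - c) ^ 2)⁻¹) :=
    hgi.add (hsi.const_mul (f c))
  rw [integral_add hgs (hp.const_mul _), integral_add hgi (hsi.const_mul _),
    integral_const_mul, integral_const_mul, hg0, hs0, integral_complex_ofReal,
    integral_sub_left_eq_self (poisson c.im) volume c.re, integral_poisson hci, hβ,
    Complex.sub_conj]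
  have h1 : (c.im : ℂ) ≠ 0 := by exact_mod_cast hci.ne'
  push_cast
  field_simp
  ring

/-! ### Elementary properties of the Hardy space -/

theorem isOpen_domainAbove {p : ℂ → ℝ} (hp : Continuous p) : IsOpen (domainAbove p) :=
  isOpen_lt (hp.comp continuous_fst) (Complex.continuous_im.comp continuous_snd)

theorem slice_mem_domainAbove (p : ℂ → ℝ) {ε : ℝ} (hε : 0 < ε) (q : ℂ × ℝ) :
    (q.1, (q.2 : ℂ) + Complex.I * (p q.1 : ℂ) + Complex.I * (ε : ℂ)) ∈ domainAbove p := by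
  simp [domainAbove, hε]

theorem continuous_slice {p : ℂ → ℝ} (hp : Continuous p) {F : ℂ × ℂ → ℂ}
    (hF : ContinuousOn F (domainAbove p)) {ε : ℝ} (hε : 0 < ε) : Continuous (slice p F ε) := by
  refine hF.comp_continuous (by fun_prop) (fun q => slice_mem_domainAbove p hε q)

theorem eLpNorm_two_sq {X : Type*} [MeasurableSpace X] (μ : Measure X) (f : X → ℂ) :
    eLpNorm f 2 μ ^ 2 = ∫⁻ q, ‖f q‖ₑ ^ 2 ∂μ := by
  have := eLpNorm_nnreal_pow_eq_lintegral (f := f) (μ := μ) (p := 2) two_ne_zero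
  simpa using this

theorem memLp_two_of_lintegral {X : Type*} [MeasurableSpace X] {μ : Measure X} {f : X → ℂ}
    (hf : AEStronglyMeasurable f μ) (h : ∫⁻ q, ‖f q‖ₑ ^ 2 ∂μ < ∞) : MemLp f 2 μ := by
  refine ⟨hf, ?_⟩
  rw [← eLpNorm_two_sq] at h
  by_contra hc
  rw [not_lt, top_le_iff] at hc
  simp [hc] at h

theorem lintegral_slice_le {p : ℂ → ℝ} (F : ℂ × ℂ → ℂ) {ε : ℝ} (hε : 0 < ε) :
    ∫⁻ q : ℂ × ℝ, ‖slice p F ε q‖ₑ ^ 2 ≤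
      ⨆ ε : Set.Ioi (0 : ℝ), ∫⁻ q : ℂ × ℝ, ‖slice p F ε q‖ₑ ^ 2 :=
  le_iSup (fun ε : Set.Ioi (0 : ℝ) => ∫⁻ q : ℂ × ℝ, ‖slice p F ε q‖ₑ ^ 2) ⟨ε, hε⟩

theorem memLp_slice {p : ℂ → ℝ} (hp : Continuous p) {F : ℂ × ℂ → ℂ} (hF : F ∈ hardySpace p)
    {ε : ℝ} (hε : 0 < ε) : MemLp (slice p F ε) 2 volume :=
  memLp_two_of_lintegral (continuous_slice hp hF.1.continuousOn hε).aestronglyMeasurable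
    ((lintegral_slice_le F hε).trans_lt hF.2)

/-! ### Pointwise estimates in the Hardy space -/

theorem measurable_indicator_domainAbove {p : ℂ → ℝ} (hp : Continuous p) {F : ℂ × ℂ → ℂ}
    (hF : ContinuousOn F (domainAbove p)) : Measurable ((domainAbove p).indicator F) := by
  classical
  rw [← Set.piecewise_eq_indicator]
  exact hF.measurable_piecewise continuousOn_const (isOpen_domainAbove hp).measurableSet

/-- The integral over a horizontal strip in coordinates adapted to its lower edge `Im v = m`. -/
theorem lintegral_strip {E : ℂ → ℝ≥0∞} (hE : Measurable E) (m h : ℝ) :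
    ∫⁻ v in {v : ℂ | v.im - m ∈ Set.Ioo 0 h}, E v =
      ∫⁻ s in Set.Ioo 0 h, ∫⁻ t : ℝ, E (t + Complex.I * m + Complex.I * s) := by
  have hms : MeasurableSet {v : ℂ | v.im - m ∈ Set.Ioo 0 h} :=
    (Complex.measurable_im.sub_const m) measurableSet_Ioo
  rw [← lintegral_indicator hms, ← lintegral_indicator measurableSet_Ioo,
    ← (Complex.volume_preserving_equiv_real_prod.symm).lintegral_comp_emb
      Complex.measurableEquivRealProd.symm.measurableEmbedding, Measure.volume_eq_prod,
    lintegral_prod_symm', ← lintegral_add_right_eq_self _ m]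
  · refine lintegral_congr fun s => ?_
    by_cases hs : s ∈ Set.Ioo 0 h
    · rw [Set.indicator_of_mem hs]
      refine lintegral_congr fun t => ?_
      rw [Set.indicator_of_mem]
      · congr 1
        apply Complex.ext <;> simp [Complex.measurableEquivRealProd]; ring
      · simpa [Complex.measurableEquivRealProd] using hs
    · rw [Set.indicator_of_notMem hs]
      refine (lintegral_congr fun t => ?_).trans lintegral_zero
      rw [Set.indicator_of_notMem]
      simpa [Complex.measurableEquivRealProd] using hs
  · exact (hE.indicator hms).comp Complex.measurableEquivRealProd.symm.measurable

theorem lintegral_strip_le_iSup {p : ℂ → ℝ} (hp : Continuous p) {F : ℂ × ℂ → ℂ}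
    (hF : ContinuousOn F (domainAbove p)) (h : ℝ) :
    ∫⁻ u : ℂ, ∫⁻ v in {v : ℂ | v.im - p u ∈ Set.Ioo 0 h}, ‖F (u, v)‖ₑ ^ 2 ≤
      ENNReal.ofReal h * ⨆ ε : Set.Ioi (0 : ℝ), ∫⁻ q : ℂ × ℝ, ‖slice p F ε q‖ₑ ^ 2 := by
  -- Nothing is known about `F` outside the domain; extension by zero supplies the measurability
  -- needed for Tonelli.
  have hG := measurable_indicator_domainAbove hp hF
  set G := (domainAbove p).indicator F with hGdef
  have hGF : ∀ z ∈ domainAbove p, G z = F z := fun z hz => Set.indicator_of_mem hz _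
  have hE : Measurable (fun z => ‖G z‖ₑ ^ 2) := by fun_prop
  have h1 : ∀ u : ℂ, ∫⁻ v in {v : ℂ | v.im - p u ∈ Set.Ioo 0 h}, ‖F (u, v)‖ₑ ^ 2 =
      ∫⁻ s in Set.Ioo 0 h, ∫⁻ t : ℝ, ‖slice p G s (u, t)‖ₑ ^ 2 := by
    intro u
    have hms : MeasurableSet {v : ℂ | v.im - p u ∈ Set.Ioo 0 h} :=
      (Complex.measurable_im.sub_const _) measurableSet_Ioo
    rw [setLIntegral_congr_fun (g := fun v => ‖G (u, v)‖ₑ ^ 2) hms,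
      lintegral_strip (by fun_prop)]
    · rfl
    · intro v hv
      simp only
      rw [hGF]
      have : 0 < v.im - p u := hv.1
      simp only [domainAbove, Set.mem_ofPred_eq]; linarith
  simp only [h1]
  rw [lintegral_lintegral_swap]
  · calc _ ≤ ∫⁻ s in Set.Ioo 0 h,
          (⨆ ε : Set.Ioi (0 : ℝ), ∫⁻ q : ℂ × ℝ, ‖slice p F ε q‖ₑ ^ 2) := by
          refine setLIntegral_mono measurable_const fun s hs => ?_
          refine le_trans (le_of_eq ?_) (lintegral_slice_le F hs.1)
          have hms : Measurable (fun q : ℂ × ℝ => ‖slice p G s q‖ₑ ^ 2) := by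
            unfold slice
            have := hp.measurable
            fun_prop
          rw [← lintegral_prod (μ := (volume : Measure ℂ)) (ν := (volume : Measure ℝ))
            (fun q : ℂ × ℝ => ‖slice p G s q‖ₑ ^ 2) hms.aemeasurable]
          refine lintegral_congr fun q => ?_
          rw [slice, hGF _ (slice_mem_domainAbove p hs.1 q), slice]
      _ = _ := by
          rw [lintegral_const, mul_comm]
          simp
  · refine Measurable.aemeasurable ?_
    refine Measurable.lintegral_prod_right' (f := fun x : (ℂ × ℝ) × ℝ =>
      ‖slice p G x.1.2 (x.1.1, x.2)‖ₑ ^ 2) ?_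
    unfold slice
    have := hp.measurable
    fun_prop

/-- The area mean value inequality is used in each variable, on a bidisc whose second radius grows
with the height `y`. The bidisc has measure of order `y²`, the strip containing it contributes at
most `2y` times the Hardy bound, and so one factor `1 / y` is gained. -/
theorem sq_norm_le_div_of_mem_hardySpace {p : ℂ → ℝ} (hp : Continuous p) {F : ℂ × ℂ → ℂ}
    (hF : F ∈ hardySpace p) (a : ℂ) {ε : ℝ} (hε : 0 < ε) :
    ∃ C : ℝ, 0 ≤ C ∧ ∀ b : ℂ, p a + ε ≤ b.im → ‖F (a, b)‖ ^ 2 ≤ C / (b.im - p a) := by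
  obtain ⟨ρ, hρ, hρp⟩ := Metric.nhds_basis_closedBall.eventually_iff.1
    ((hp.tendsto a).eventually (Metric.closedBall_mem_nhds (p a) (by linarith : 0 < ε / 4)))
  set N := ⨆ ε : Set.Ioi (0 : ℝ), ∫⁻ q : ℂ × ℝ, ‖slice p F ε q‖ₑ ^ 2 with hN
  refine ⟨8 * N.toReal / (π ^ 2 * ρ ^ 2), by positivity, fun b hb => ?_⟩
  set y := b.im - p a with hy
  have hyε : ε ≤ y := by linarith
  have hy0 : 0 < y := by linarith
  -- On the first disc `p` varies by at most `ε / 4 ≤ y / 4`, so heights stay between `y / 4` and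
  -- `7y / 4`.
  have hin : ∀ u ∈ Metric.closedBall a ρ, ∀ v ∈ Metric.closedBall b (y / 2),
      v.im - p u ∈ Set.Ioo 0 (2 * y) := by
    intro u hu v hv
    have h1 := hρp hu
    rw [Real.dist_eq, abs_le] at h1
    have h2 := (Complex.abs_im_le_norm (v - b)).trans (mem_closedBall_iff_norm.1 hv)
    rw [Complex.sub_im, abs_le] at h2
    constructor <;> linarith
  have hdom : ∀ u ∈ Metric.closedBall a ρ, ∀ v ∈ Metric.closedBall b (y / 2),
      (u, v) ∈ domainAbove p := by
    intro u hu v hv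
    have : 0 < v.im - p u := (hin u hu v hv).1
    simp only [domainAbove, Set.mem_ofPred_eq]; linarith
  have hb0 : b ∈ Metric.closedBall b (y / 2) := Metric.mem_closedBall_self (by linarith)
  have h1 := sq_norm_le_lintegral_ball (g := fun u => F (u, b)) (c := a) hρ
    (hF.1.comp (by fun_prop) fun u hu => hdom u hu b hb0)
  have h2 : ∀ u ∈ Metric.ball a ρ, ENNReal.ofReal (π * (y / 2) ^ 2) * ‖F (u, b)‖ₑ ^ 2 ≤
      ∫⁻ v in {v : ℂ | v.im - p u ∈ Set.Ioo 0 (2 * y)}, ‖F (u, v)‖ₑ ^ 2 := by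
    intro u hu
    have hu' := Metric.ball_subset_closedBall hu
    refine (sq_norm_le_lintegral_ball (g := fun v => F (u, v)) (c := b) (by linarith)
      (hF.1.comp (by fun_prop) fun v hv => hdom u hu' v hv)).trans ?_
    exact lintegral_mono_set fun v hv => hin u hu' v (Metric.ball_subset_closedBall hv)
  have h3 : ENNReal.ofReal (π * (y / 2) ^ 2) * (ENNReal.ofReal (π * ρ ^ 2) * ‖F (a, b)‖ₑ ^ 2)
      ≤ ENNReal.ofReal (2 * y) * N := by
    calc _ ≤ ENNReal.ofReal (π * (y / 2) ^ 2) * ∫⁻ u in Metric.ball a ρ, ‖F (u, b)‖ₑ ^ 2 := by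
          gcongr
      _ = ∫⁻ u in Metric.ball a ρ, ENNReal.ofReal (π * (y / 2) ^ 2) * ‖F (u, b)‖ₑ ^ 2 := by
          rw [lintegral_const_mul' _ _ ENNReal.ofReal_ne_top]
      _ ≤ ∫⁻ u in Metric.ball a ρ,
          ∫⁻ v in {v : ℂ | v.im - p u ∈ Set.Ioo 0 (2 * y)}, ‖F (u, v)‖ₑ ^ 2 :=
          setLIntegral_mono' measurableSet_ball h2
      _ ≤ _ := (setLIntegral_le_lintegral _ _).trans
          (lintegral_strip_le_iSup hp hF.1.continuousOn _)
  have h4 := ENNReal.toReal_mono (ENNReal.mul_ne_top ENNReal.ofReal_ne_top hF.2.ne) h3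
  simp only [ENNReal.toReal_mul, ENNReal.toReal_pow, toReal_enorm] at h4
  rw [ENNReal.toReal_ofReal (by positivity), ENNReal.toReal_ofReal (by positivity),
    ENNReal.toReal_ofReal (by positivity)] at h4
  rw [div_div, le_div_iff₀ (by positivity)]
  have h5 : y * (‖F (a, b)‖ ^ 2 * (π ^ 2 * ρ ^ 2 * y)) ≤ y * (8 * N.toReal) := by
    nlinarith
  exact le_of_mul_le_mul_left h5 hy0

theorem exists_norm_le_of_mem_hardySpace {p : ℂ → ℝ} (hp : Continuous p) {F : ℂ × ℂ → ℂ}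
    (hF : F ∈ hardySpace p) (a : ℂ) {ε : ℝ} (hε : 0 < ε) :
    ∃ M : ℝ, ∀ b : ℂ, p a + ε ≤ b.im → ‖F (a, b)‖ ≤ M := by
  obtain ⟨C, hC0, hC⟩ := sq_norm_le_div_of_mem_hardySpace hp hF a hε
  refine ⟨√(C / ε), fun b hb => Real.le_sqrt_of_sq_le ((hC b hb).trans ?_)⟩
  gcongr
  linarith

theorem tendsto_zero_of_mem_hardySpace {p : ℂ → ℝ} (hp : Continuous p) {F : ℂ × ℂ → ℂ}
    (hF : F ∈ hardySpace p) (a : ℂ) {ι : Type*} {𝓕 : Filter ι} {b : ι → ℂ}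
    (hb : Tendsto (fun i => (b i).im) 𝓕 atTop) : Tendsto (fun i => F (a, b i)) 𝓕 (𝓝 0) := by
  obtain ⟨C, hC0, hC⟩ := sq_norm_le_div_of_mem_hardySpace hp hF a one_pos
  have h1 : Tendsto (fun i => C / ((b i).im - p a)) 𝓕 (𝓝 0) :=
    tendsto_const_nhds.div_atTop (tendsto_atTop_add_const_right _ _ hb)
  have h2 : Tendsto (fun i => ‖F (a, b i)‖ ^ 2) 𝓕 (𝓝 0) :=
    squeeze_zero' (Eventually.of_forall fun i => sq_nonneg _)
      ((hb.eventually_ge_atTop (p a + 1)).mono fun i hi => hC _ hi) h1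
  have h3 := h2.sqrt
  simp only [Real.sqrt_sq (norm_nonneg _), Real.sqrt_zero] at h3
  exact tendsto_zero_iff_norm_tendsto_zero.2 h3

/-! ### Existence of boundary values -/

/-- The shift identity acts like self-adjointness of a semigroup: it makes `⟪u ε, u δ⟫` the squared
norm at the midpoint, so convergence of the norms controls the differences. -/
theorem tendsto_of_inner_shift {H : Type*} [NormedAddCommGroup H] [InnerProductSpace ℂ H]
    [CompleteSpace H] {u : ℝ → H} {M : ℝ} (hM : ∀ ε > 0, ‖u ε‖ ^ 2 ≤ M)
    (hs : ∀ ε > 0, ∀ δ > 0, ∀ η > 0, inner ℂ (u (ε + η)) (u δ) = inner ℂ (u ε) (u (δ + η))) :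
    ∃ f, Tendsto u (𝓝[>] 0) (𝓝 f) := by
  set N : ℝ → ℝ := fun ε => ‖u ε‖ ^ 2 with hN
  have key' : ∀ ε > 0, ∀ δ, ε < δ → ‖u ε - u δ‖ ^ 2 = N ε + N δ - 2 * N ((ε + δ) / 2) := by
    intro ε hε δ hεδ
    have h := hs ε hε ((ε + δ) / 2) (by linarith) ((δ - ε) / 2) (by linarith)
    rw [show ε + (δ - ε) / 2 = (ε + δ) / 2 by ring,
      show (ε + δ) / 2 + (δ - ε) / 2 = δ by ring] at h
    rw [norm_sub_sq (𝕜 := ℂ), ← h, inner_self_eq_norm_sq]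
    simp only [hN]; ring
  have key : ∀ ε > 0, ∀ δ > 0, ‖u ε - u δ‖ ^ 2 = N ε + N δ - 2 * N ((ε + δ) / 2) := by
    intro ε hε δ hδ
    rcases lt_trichotomy ε δ with h | h | h
    · exact key' ε hε δ h
    · subst h
      simp only [sub_self, norm_zero, add_self_div_two]; ring
    · rw [norm_sub_rev, key' δ hδ ε h, add_comm δ ε]; ring
  have hanti : ∀ a > 0, ∀ b, a < b → N b ≤ N a := by
    intro a ha b hab
    by_contra hc
    rw [not_le] at hc
    have hd : 0 < b - a := by linarith
    -- By midpoint convexity an increase of `N` would persist along the arithmetic progression and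
    -- eventually exceed `M`.
    have hstep : ∀ k : ℕ, N b - N a ≤ N (a + (k + 1) * (b - a)) - N (a + k * (b - a)) := by
      intro k
      induction k with
      | zero =>
        refine le_of_eq ?_
        norm_num
      | succ k ih =>
        have h1 := key (a + k * (b - a)) (by positivity) (a + (k + 2) * (b - a)) (by positivity)
        rw [show (a + k * (b - a) + (a + (k + 2) * (b - a))) / 2 = a + (k + 1) * (b - a) by ring]
          at h1
        have h2 := sq_nonneg ‖u (a + k * (b - a)) - u (a + (k + 2) * (b - a))‖
        push_cast
        rw [show (k : ℝ) + 1 + 1 = k + 2 by ring]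
        linarith
    have hsum : ∀ k : ℕ, N a + k * (N b - N a) ≤ N (a + k * (b - a)) := by
      intro k
      induction k with
      | zero => simp
      | succ k ih =>
        have := hstep k
        push_cast
        linarith
    obtain ⟨k, hk⟩ := exists_nat_gt ((M - N a) / (N b - N a))
    rw [div_lt_iff₀ (by linarith)] at hk
    have h1 := hsum k
    have h2 : N (a + k * (b - a)) ≤ M := hM _ (by positivity)
    linarith
  have hbdd : BddAbove (N '' Set.Ioi 0) := ⟨M, by rintro _ ⟨ε, hε, rfl⟩; exact hM ε hε⟩
  have hle : ∀ ε > 0, N ε ≤ sSup (N '' Set.Ioi 0) := fun ε hε =>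
    le_csSup hbdd (Set.mem_image_of_mem _ hε)
  apply cauchy_map_iff_exists_tendsto.1
  rw [Metric.cauchy_iff]
  refine ⟨inferInstance, fun e he => ?_⟩
  obtain ⟨_, ⟨a, ha, rfl⟩, hNa⟩ := exists_lt_of_lt_csSup
    (⟨N 1, Set.mem_image_of_mem _ (by simp)⟩ : (N '' Set.Ioi 0).Nonempty)
    (by linarith [sq_pos_of_pos he] : sSup (N '' Set.Ioi 0) - e ^ 2 / 2 < sSup (N '' Set.Ioi 0))
  have ha0 : 0 < a := ha
  refine ⟨u '' Set.Ioo 0 a, image_mem_map (Ioo_mem_nhdsGT ha0), ?_⟩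
  rintro _ ⟨ε, hε, rfl⟩ _ ⟨δ, hδ, rfl⟩
  rw [dist_eq_norm, ← sq_lt_sq₀ (norm_nonneg _) he.le, key ε hε.1 δ hδ.1]
  have h1 := hle ε hε.1
  have h2 := hle δ hδ.1
  have h3 := hanti ((ε + δ) / 2) (by linarith [hε.1, hδ.1]) a (by linarith [hε.2, hδ.2])
  linarith

/-- Fubini and evenness of the kernel; `P(x - t)(|u(t)|² + |v(x)|²)` is the integrable majorant. -/
theorem poisson_symmetric {u v : ℝ → ℂ} (hu : MemLp u 2) (hv : MemLp v 2) {η : ℝ} (hη : 0 < η) :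
    ∫ x, (∫ t, (poisson η (x - t) : ℂ) * u t) * conj (v x) =
      ∫ t, u t * conj (∫ x, (poisson η (t - x) : ℂ) * v x) := by
  have hu2 : Integrable (fun t => ‖u t‖ ^ 2) := (memLp_two_iff_integrable_sq_norm hu.1).1 hu
  have hv2 : Integrable (fun t => ‖v t‖ ^ 2) := (memLp_two_iff_integrable_sq_norm hv.1).1 hv
  have h1 := hu2.convolution_integrand (ContinuousLinearMap.mul ℝ ℝ) (integrable_poisson hη)
  have h2 := (hv2.convolution_integrand (ContinuousLinearMap.mul ℝ ℝ)
    (integrable_poisson hη)).swap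
  have hint : Integrable (fun q : ℝ × ℝ => (poisson η (q.1 - q.2) : ℂ) * u q.2 * conj (v q.1))
      (volume.prod volume) := by
    refine (h1.add h2).mono' ?_ (Eventually.of_forall fun q => ?_)
    · refine AEStronglyMeasurable.mul (AEStronglyMeasurable.mul ?_ hu.1.comp_snd) ?_
      · have := continuous_poisson hη
        exact (by fun_prop : Continuous fun q : ℝ × ℝ =>
          (poisson η (q.1 - q.2) : ℂ)).aestronglyMeasurable
      · exact Complex.continuous_conj.comp_aestronglyMeasurable hv.1.comp_fst
    · simp only [norm_mul, RCLike.norm_conj, Complex.norm_real, Pi.add_apply, Function.comp,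
        ContinuousLinearMap.mul_apply', Prod.fst_swap, Prod.snd_swap,
        Real.norm_of_nonneg (poisson_nonneg hη _)]
      rw [← poisson_neg η (q.2 - q.1), neg_sub]
      have h := poisson_nonneg hη (q.1 - q.2)
      have h' : ‖u q.2‖ * ‖v q.1‖ ≤ ‖u q.2‖ ^ 2 + ‖v q.1‖ ^ 2 := by
        nlinarith [sq_nonneg (‖u q.2‖ - ‖v q.1‖), sq_nonneg ‖u q.2‖, sq_nonneg ‖v q.1‖]
      nlinarith [mul_le_mul_of_nonneg_left h' h]
  have hswap := integral_integral_swap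
    (f := fun x t => (poisson η (x - t) : ℂ) * u t * conj (v x)) hint
  simp only [integral_mul_const] at hswap
  rw [hswap]
  refine integral_congr_ae (Eventually.of_forall fun t => ?_)
  simp only
  rw [← integral_conj, ← integral_const_mul]
  congr 1 with x
  rw [← poisson_neg η (x - t), neg_sub, map_mul, Complex.conj_ofReal]
  ring

theorem slice_poisson {p : ℂ → ℝ} (hp : Continuous p) {F : ℂ × ℂ → ℂ} (hF : F ∈ hardySpace p)
    {ε η : ℝ} (hε : 0 < ε) (hη : 0 < η) (ζ : ℂ) (x : ℝ) :
    ∫ t : ℝ, (poisson η (x - t) : ℂ) * slice p F ε (ζ, t) = slice p F (ε + η) (ζ, x) := by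
  obtain ⟨M, hM⟩ := exists_norm_le_of_mem_hardySpace hp hF ζ hε
  have h := poisson_integral (f := fun z => F (ζ, z + Complex.I * p ζ + Complex.I * ε)) (M := M) hε
    (hF.1.comp (by fun_prop) fun z hz => by
      have : -ε < z.im := hz
      simp only [domainAbove, Set.mem_ofPred_eq]
      simp; linarith) (fun z hz => hM _ (by simp; linarith)) hη x
  simp only [slice]
  rw [h]
  congr 2
  push_cast
  ring

theorem inner_slice_shift {p : ℂ → ℝ} (hp : Continuous p) {F : ℂ × ℂ → ℂ} (hF : F ∈ hardySpace p)
    {ε δ η : ℝ} (hε : 0 < ε) (hδ : 0 < δ) (hη : 0 < η) :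
    ∫ q, slice p F (ε + η) q * conj (slice p F δ q) =
      ∫ q, slice p F ε q * conj (slice p F (δ + η) q) := by
  have hi : ∀ {a b : ℝ}, 0 < a → 0 < b →
      Integrable (fun q => slice p F a q * conj (slice p F b q)) (volume.prod volume) :=
    fun ha hb => (memLp_slice hp hF ha).integrable_mul (memLp_slice hp hF hb).star
  have hae : ∀ {a : ℝ}, 0 < a → ∀ᵐ ζ : ℂ, MemLp (fun t : ℝ => slice p F a (ζ, t)) 2 := by
    intro a ha
    have hc := continuous_slice hp hF.1.continuousOn ha
    have h := (memLp_two_iff_integrable_sq_norm hc.aestronglyMeasurable).1 (memLp_slice hp hF ha)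
    filter_upwards [(show Integrable _ (volume.prod volume) from h).prod_right_ae] with ζ hζ
    refine (memLp_two_iff_integrable_sq_norm ?_).2 hζ
    exact (hc.comp (by fun_prop : Continuous fun t : ℝ => (ζ, t))).aestronglyMeasurable
  rw [Measure.volume_eq_prod, integral_prod _ (hi (by linarith) hδ),
    integral_prod _ (hi hε (by linarith))]
  refine integral_congr_ae ?_
  filter_upwards [hae hε, hae hδ] with ζ h1 h2
  have h := poisson_symmetric h1 h2 hη
  simp only [slice_poisson hp hF hε hη, slice_poisson hp hF hδ hη] at h
  exact h

theorem exists_isBoundaryValue {p : ℂ → ℝ} (hp : Continuous p) {F : ℂ × ℂ → ℂ}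
    (hF : F ∈ hardySpace p) : ∃ f, IsBoundaryValue p F f := by
  classical
  set u : ℝ → Lp ℂ 2 (volume : Measure (ℂ × ℝ)) := fun ε =>
    if h : 0 < ε then (memLp_slice hp hF h).toLp _ else 0 with hu
  have hue : ∀ {ε : ℝ} (h : 0 < ε), u ε = (memLp_slice hp hF h).toLp _ := fun h => by
    simp only [hu, dif_pos h]
  have hinner : ∀ {a b : ℝ}, 0 < a → 0 < b →
      inner ℂ (u a) (u b) = ∫ q, slice p F b q * conj (slice p F a q) := by
    intro a b ha hb
    rw [L2.inner_def, hue ha, hue hb]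
    refine integral_congr_ae ?_
    filter_upwards [(memLp_slice hp hF ha).coeFn_toLp, (memLp_slice hp hF hb).coeFn_toLp]
      with q h1 h2
    rw [h1, h2]
    rfl
  set N := ⨆ ε : Set.Ioi (0 : ℝ), ∫⁻ q : ℂ × ℝ, ‖slice p F ε q‖ₑ ^ 2 with hN
  obtain ⟨f, hf⟩ := tendsto_of_inner_shift (u := u) (M := N.toReal)
    (fun ε hε => by
      rw [hue hε, Lp.norm_toLp, ← ENNReal.toReal_pow, eLpNorm_two_sq]
      exact ENNReal.toReal_mono hF.2.ne (lintegral_slice_le F hε))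
    (fun ε hε δ hδ η hη => by
      rw [hinner (by linarith) hδ, hinner hε (by linarith), ← inner_slice_shift hp hF hδ hε hη])
  refine ⟨f, Lp.memLp f, ?_⟩
  have h := (Lp.tendsto_Lp_iff_tendsto_eLpNorm' u f).1 hf
  refine h.congr' ?_
  filter_upwards [self_mem_nhdsWithin] with ε hε
  refine eLpNorm_congr_ae ?_
  rw [hue hε]
  filter_upwards [(memLp_slice hp hF hε).coeFn_toLp] with q hq
  simp [hq]

/-- `IsSzegoKernel` provides boundary values only existentially; the uniqueness proof must identify
two choices for the same function. -/
theorem IsBoundaryValue.ae_eq {p : ℂ → ℝ} (hp : Continuous p) {F : ℂ × ℂ → ℂ}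
    (hF : F ∈ hardySpace p) {f g : ℂ × ℝ → ℂ} (hf : IsBoundaryValue p F f)
    (hg : IsBoundaryValue p F g) : f =ᵐ[volume] g := by
  have h : Tendsto (fun ε : ℝ => eLpNorm (fun q => slice p F ε q - f q) 2 volume +
      eLpNorm (fun q => slice p F ε q - g q) 2 volume) (𝓝[>] 0) (𝓝 0) := by
    simpa using hf.2.add hg.2
  have h0 : eLpNorm (f - g) 2 volume ≤ 0 := by
    refine ge_of_tendsto h ?_
    filter_upwards [self_mem_nhdsWithin] with ε hε
    have hm := (memLp_slice hp hF hε).1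
    have : f - g = (fun q => slice p F ε q - g q) - (fun q => slice p F ε q - f q) := by
      ext q; simp
    rw [this, add_comm]
    exact eLpNorm_sub_le (hm.sub hg.1.1) (hm.sub hf.1.1) (by norm_num)
  have h1 := (eLpNorm_eq_zero_iff (hf.1.1.sub hg.1.1) two_ne_zero).1 (le_antisymm h0 bot_le)
  filter_upwards [h1] with q hq
  exact sub_eq_zero.1 hq

/-! ### The explicit Szegő kernel of the model domain -/

/-- The expression whose inverse square is, up to a constant, the Szegő kernel. -/
noncomputable def szegoBracket (κ : ℝ) (l : ℂ) (z w : ℂ × ℂ) : ℂ :=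
  Complex.I * (conj w.2 - z.2) - 2 * κ * z.1 * conj w.1 - (l * z.1 ^ 2 + conj l * conj w.1 ^ 2)

/-- The explicit Szegő kernel of the model domain. -/
noncomputable def modelSzego (κ : ℝ) (l : ℂ) (z w : ℂ × ℂ) : ℂ :=
  κ / π ^ 2 * szegoBracket κ l z w ^ (-2 : ℤ)

theorem modelSzego_eq (κ : ℝ) (l : ℂ) (z w : ℂ × ℂ) :
    modelSzego κ l z w = κ / π ^ 2 * (szegoBracket κ l z w ^ 2)⁻¹ := by
  rw [modelSzego, zpow_neg]
  norm_cast

theorem conj_szegoBracket (κ : ℝ) (l : ℂ) (z w : ℂ × ℂ) :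
    conj (szegoBracket κ l z w) = szegoBracket κ l w z := by
  simp only [szegoBracket, map_sub, map_mul, map_add, map_pow, Complex.conj_conj,
    Complex.conj_ofReal, Complex.conj_I, map_ofNat]
  ring

theorem conj_modelSzego (κ : ℝ) (l : ℂ) (z w : ℂ × ℂ) :
    conj (modelSzego κ l z w) = modelSzego κ l w z := by
  rw [modelSzego_eq, modelSzego_eq, map_mul, map_inv₀, map_pow, conj_szegoBracket]
  simp

/-- The heights of both points above the boundary plus a square: this gives positivity, hence no
zeros, and the quadratic growth in `z.1` behind square integrability. -/
theorem re_szegoBracket (κ : ℝ) (l : ℂ) (z w : ℂ × ℂ) :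
    (szegoBracket κ l z w).re =
      (z.2.im - quad κ l z.1) + (w.2.im - quad κ l w.1) + κ * ‖z.1 - w.1‖ ^ 2 := by
  simp only [szegoBracket, quad, ← Complex.normSq_eq_norm_sq, Complex.normSq_apply]
  simp [sq]
  ring

theorem szegoBracket_slice (κ : ℝ) (l ζ : ℂ) (z w : ℂ × ℂ) (ε : ℝ) :
    szegoBracket κ l (ζ, z.2 + Complex.I * ε) w = szegoBracket κ l (ζ, z.2) w + ε := by
  simp only [szegoBracket]
  linear_combination (-(ε : ℂ)) * Complex.I_sq

theorem szegoBracket_re_pos {κ : ℝ} (hκ : 0 < κ) {l : ℂ} {z w : ℂ × ℂ}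
    (hz : quad κ l z.1 ≤ z.2.im) (hw : w ∈ domainAbove (quad κ l)) :
    0 < (szegoBracket κ l z w).re := by
  have h : quad κ l w.1 < w.2.im := hw
  rw [re_szegoBracket]
  have : 0 ≤ κ * ‖z.1 - w.1‖ ^ 2 := by positivity
  linarith

theorem szegoBracket_ne_zero {κ : ℝ} (hκ : 0 < κ) {l : ℂ} {z w : ℂ × ℂ}
    (hz : quad κ l z.1 ≤ z.2.im) (hw : w ∈ domainAbove (quad κ l)) :
    szegoBracket κ l z w ≠ 0 := fun h => by
  have := szegoBracket_re_pos hκ hz hw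
  simp [h] at this

/-- The point of the boundary with parameters `q`. -/
noncomputable def boundaryPoint (p : ℂ → ℝ) (q : ℂ × ℝ) : ℂ × ℂ :=
  (q.1, (q.2 : ℂ) + Complex.I * (p q.1 : ℂ))

theorem boundaryPoint_im (p : ℂ → ℝ) (q : ℂ × ℝ) :
    (boundaryPoint p q).2.im = p (boundaryPoint p q).1 := by
  simp [boundaryPoint]

/-- The boundary value of the explicit Szegő kernel with second argument `w`. -/
noncomputable def szegoBoundary (κ : ℝ) (l : ℂ) (w : ℂ × ℂ) (q : ℂ × ℝ) : ℂ :=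
  modelSzego κ l (boundaryPoint (quad κ l) q) w

theorem szegoBracket_slice_eq (κ : ℝ) (l : ℂ) (w : ℂ × ℂ) (ε : ℝ) (q : ℂ × ℝ) :
    szegoBracket κ l (q.1, (q.2 : ℂ) + Complex.I * (quad κ l q.1 : ℂ) + Complex.I * ε) w =
      szegoBracket κ l (boundaryPoint (quad κ l) q) w + ε :=
  szegoBracket_slice κ l q.1 (boundaryPoint (quad κ l) q) w ε

theorem norm_le_norm_add_of_re_nonneg {A : ℂ} (hA : 0 ≤ A.re) {ε : ℝ} (hε : 0 ≤ ε) :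
    ‖A‖ ≤ ‖A + ε‖ := by
  rw [← sq_le_sq₀ (norm_nonneg _) (norm_nonneg _), ← Complex.normSq_eq_norm_sq,
    ← Complex.normSq_eq_norm_sq, Complex.normSq_apply, Complex.normSq_apply]
  simp
  nlinarith

/-- The bound is relative to `(A ^ 2)⁻¹`, so `L²` convergence of the slices follows from one `L²`
bound at the boundary. -/
theorem norm_inv_sq_sub_inv_sq_le {A : ℂ} {δ : ℝ} (hδ : 0 < δ) (hA : δ ≤ A.re) {ε : ℝ}
    (hε : 0 ≤ ε) : ‖((A + ε) ^ 2)⁻¹ - (A ^ 2)⁻¹‖ ≤ 2 * ε / δ * ‖(A ^ 2)⁻¹‖ := by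
  have hre : δ ≤ (A + ε).re := by simp; linarith
  have h1 : δ ≤ ‖A + ε‖ := hre.trans (Complex.re_le_norm _)
  have h2 : ‖A‖ ≤ ‖A + ε‖ := norm_le_norm_add_of_re_nonneg (by linarith) hε
  have hA0 : A ≠ 0 := fun h => by simp [h] at hA; linarith
  have hAe : A + ε ≠ 0 := fun h => by simp [h] at hre; linarith
  have e : ((A + ε) ^ 2)⁻¹ - (A ^ 2)⁻¹ = -(ε * (A + (A + ε))) / (A + ε) ^ 2 * (A ^ 2)⁻¹ := by
    field_simp
    ring
  rw [e, norm_mul]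
  gcongr
  rw [norm_div, norm_neg, norm_mul, norm_pow, Complex.norm_real, Real.norm_of_nonneg hε,
    div_le_div_iff₀ (by positivity) hδ]
  have h3 : ‖A + (A + ε)‖ ≤ 2 * ‖A + ε‖ := (norm_add_le _ _).trans (by linarith)
  calc ε * ‖A + (A + ε)‖ * δ ≤ ε * (2 * ‖A + ε‖) * ‖A + ε‖ := by gcongr
    _ = 2 * ε * ‖A + ε‖ ^ 2 := by ring

theorem norm_slice_modelSzego_le {κ : ℝ} (hκ : 0 < κ) {l : ℂ} {w : ℂ × ℂ}
    (hw : w ∈ domainAbove (quad κ l)) {ε : ℝ} (hε : 0 ≤ ε) (q : ℂ × ℝ) :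
    ‖slice (quad κ l) (fun z => modelSzego κ l z w) ε q‖ ≤ ‖szegoBoundary κ l w q‖ := by
  have h0 := szegoBracket_re_pos hκ (boundaryPoint_im (quad κ l) q).ge hw
  have h1 : 0 < ‖szegoBracket κ l (boundaryPoint (quad κ l) q) w‖ :=
    h0.trans_le (Complex.re_le_norm _)
  simp only [slice, szegoBoundary, modelSzego_eq, szegoBracket_slice_eq, norm_mul, norm_inv,
    norm_pow]
  gcongr
  exact norm_le_norm_add_of_re_nonneg h0.le hε

theorem norm_slice_modelSzego_sub_le {κ : ℝ} (hκ : 0 < κ) {l : ℂ} {w : ℂ × ℂ}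
    (hw : w ∈ domainAbove (quad κ l)) {ε : ℝ} (hε : 0 ≤ ε) (q : ℂ × ℝ) :
    ‖slice (quad κ l) (fun z => modelSzego κ l z w) ε q - szegoBoundary κ l w q‖ ≤
      2 * ε / (w.2.im - quad κ l w.1) * ‖szegoBoundary κ l w q‖ := by
  have hδ : 0 < w.2.im - quad κ l w.1 := sub_pos.2 hw
  have hre : w.2.im - quad κ l w.1 ≤ (szegoBracket κ l (boundaryPoint (quad κ l) q) w).re := by
    rw [re_szegoBracket, boundaryPoint_im]
    have : 0 ≤ κ * ‖(boundaryPoint (quad κ l) q).1 - w.1‖ ^ 2 := by positivity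
    linarith
  have h := norm_inv_sq_sub_inv_sq_le hδ hre hε
  simp only [slice, szegoBoundary, modelSzego_eq, szegoBracket_slice_eq]
  rw [← mul_sub, norm_mul, norm_mul]
  calc _ ≤ _ := mul_le_mul_of_nonneg_left h (norm_nonneg _)
    _ = _ := by ring

theorem continuous_szegoBoundary {κ : ℝ} (hκ : 0 < κ) {l : ℂ} {w : ℂ × ℂ}
    (hw : w ∈ domainAbove (quad κ l)) : Continuous (szegoBoundary κ l w) := by
  have hq := continuous_quad κ l
  unfold szegoBoundary
  simp only [modelSzego_eq]
  refine continuous_const.mul (Continuous.inv₀ ?_ fun q =>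
    pow_ne_zero 2 (szegoBracket_ne_zero hκ (boundaryPoint_im (quad κ l) q).ge hw))
  unfold szegoBracket boundaryPoint
  have hc : Continuous fun q : ℂ × ℝ => (quad κ l q.1 : ℂ) := by fun_prop
  fun_prop

theorem integrable_inv_sq_one_add_sq_norm :
    Integrable (fun ζ : ℂ => ((1 + ‖ζ‖ ^ 2) ^ 2)⁻¹) := by
  have h := integrable_rpow_neg_one_add_norm_sq (E := ℂ) (μ := volume) (r := 4)
    (by rw [Complex.finrank_real_complex]; norm_num)
  refine h.congr (Eventually.of_forall fun ζ => ?_)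
  simp only
  rw [show (-4 / 2 : ℝ) = ((-2 : ℤ) : ℝ) by norm_num, Real.rpow_intCast, zpow_neg]
  norm_cast

theorem integrable_shear {f : ℂ → ℝ} {g : ℝ → ℝ} (hf : Integrable f) (hg : Integrable g)
    {b : ℂ → ℝ} (hb : Continuous b) :
    Integrable (fun q : ℂ × ℝ => f q.1 * g (q.2 - b q.1)) := by
  have hmp : MeasurePreserving (fun q : ℂ × ℝ => (q.1, q.2 - b q.1))
      (volume.prod volume) (volume.prod volume) := by
    refine (MeasurePreserving.id _).skew_product (g := fun ζ t => t - b ζ) ?_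
      (Eventually.of_forall fun ζ => (measurePreserving_sub_right volume (b ζ)).map_eq)
    have := hb.measurable
    simp only [Function.uncurry_def]
    fun_prop
  exact hmp.integrable_comp_of_integrable (hf.mul_prod hg)

theorem memLp_szegoBoundary {κ : ℝ} (hκ : 0 < κ) {l : ℂ} {w : ℂ × ℂ}
    (hw : w ∈ domainAbove (quad κ l)) : MemLp (szegoBoundary κ l w) 2 volume := by
  have hc := (continuous_szegoBoundary hκ hw).aestronglyMeasurable (μ := volume)
  rw [memLp_two_iff_integrable_sq_norm hc]
  have hδ : 0 < w.2.im - quad κ l w.1 := sub_pos.2 hw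
  set δ := w.2.im - quad κ l w.1 with hδd
  -- The value of `t` at which the imaginary part of the bracket vanishes; the shear `t ↦ t - b ζ`
  -- preserves measure and separates the majorant into a product.
  set b : ℂ → ℝ := fun ζ =>
    (conj w.2 - Complex.I * (- 2 * κ * ζ * conj w.1 - (l * ζ ^ 2 + conj l * conj w.1 ^ 2))).re
    with hb
  have hbc : Continuous b := Complex.continuous_re.comp (by fun_prop)
  set m := min δ κ with hm
  have hm0 : 0 < m := lt_min hδ hκ
  set C := (κ / π ^ 2) ^ 2 * (m ^ 2 * min (m ^ 2) 1)⁻¹ with hC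
  have hint := (integrable_shear (integrable_inv_sq_one_add_sq_norm.comp_sub_right w.1)
    integrable_inv_one_add_sq hbc).const_mul C
  refine hint.mono' (hc.norm.pow 2) (Eventually.of_forall fun q => ?_)
  set A := szegoBracket κ l (boundaryPoint (quad κ l) q) w with hA
  have hre : A.re = δ + κ * ‖q.1 - w.1‖ ^ 2 := by
    rw [hA, re_szegoBracket, boundaryPoint_im]
    simp [boundaryPoint, hδd]
  have him : A.im = -(q.2 - b q.1) := by
    simp [hA, szegoBracket, boundaryPoint, hb]
    ring
  have h1 : m * (1 + ‖q.1 - w.1‖ ^ 2) ≤ A.re := by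
    rw [hre]
    nlinarith [min_le_left δ κ, min_le_right δ κ, sq_nonneg ‖q.1 - w.1‖]
  have h2 : min (m ^ 2) 1 * (1 + (q.2 - b q.1) ^ 2) ≤ ‖A‖ ^ 2 := by
    rw [← Complex.normSq_eq_norm_sq, Complex.normSq_apply, him]
    have h5 : m ≤ A.re := by nlinarith [sq_nonneg ‖q.1 - w.1‖]
    have h4 : m ^ 2 ≤ A.re * A.re := by nlinarith
    nlinarith [min_le_left (m ^ 2) 1, min_le_right (m ^ 2) 1, sq_nonneg (q.2 - b q.1)]
  have h3 : m ^ 2 * (1 + ‖q.1 - w.1‖ ^ 2) ^ 2 ≤ ‖A‖ ^ 2 := by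
    rw [← mul_pow]
    gcongr
    exact h1.trans (Complex.re_le_norm _)
  rw [Real.norm_of_nonneg (by positivity), szegoBoundary, modelSzego_eq, norm_mul, mul_pow, ← hA]
  have hmm : 0 < min (m ^ 2) 1 := lt_min (by positivity) one_pos
  have e : ‖(κ / π ^ 2 : ℂ)‖ = κ / π ^ 2 := by
    rw [show (κ / π ^ 2 : ℂ) = ((κ / π ^ 2 : ℝ) : ℂ) by push_cast; rfl, Complex.norm_real,
      Real.norm_of_nonneg (by positivity)]
  rw [e, hC, mul_assoc]
  refine mul_le_mul_of_nonneg_left ?_ (by positivity)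
  rw [norm_inv, norm_pow, inv_pow, ← mul_inv, ← mul_inv]
  gcongr
  calc _ = (m ^ 2 * (1 + ‖q.1 - w.1‖ ^ 2) ^ 2) * (min (m ^ 2) 1 * (1 + (q.2 - b q.1) ^ 2)) := by
        ring
    _ ≤ ‖A‖ ^ 2 * ‖A‖ ^ 2 := by gcongr
    _ = _ := by ring

theorem isBoundaryValue_szegoBoundary {κ : ℝ} (hκ : 0 < κ) {l : ℂ} {w : ℂ × ℂ}
    (hw : w ∈ domainAbove (quad κ l)) :
    IsBoundaryValue (quad κ l) (fun z => modelSzego κ l z w) (szegoBoundary κ l w) := by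
  have hm := memLp_szegoBoundary hκ hw
  refine ⟨hm, ?_⟩
  have hlim : Tendsto (fun ε : ℝ => ENNReal.ofReal (2 * ε / (w.2.im - quad κ l w.1)) *
      eLpNorm (szegoBoundary κ l w) 2 volume) (𝓝[>] 0) (𝓝 0) := by
    have h1 : Tendsto (fun ε : ℝ => 2 * ε / (w.2.im - quad κ l w.1)) (𝓝[>] 0) (𝓝 0) := by
      have : Continuous (fun ε : ℝ => 2 * ε / (w.2.im - quad κ l w.1)) := by fun_prop
      simpa using (this.tendsto 0).mono_left nhdsWithin_le_nhds
    have h2 := ENNReal.Tendsto.mul_const (ENNReal.tendsto_ofReal h1) (Or.inr hm.2.ne)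
    simpa using h2
  refine tendsto_of_tendsto_of_tendsto_of_le_of_le' tendsto_const_nhds hlim
    (Eventually.of_forall fun _ => bot_le) ?_
  filter_upwards [self_mem_nhdsWithin] with ε hε
  exact eLpNorm_le_mul_eLpNorm_of_ae_le_mul
    (Eventually.of_forall fun q => norm_slice_modelSzego_sub_le hκ hw (le_of_lt hε) q) 2

theorem modelSzego_mem_hardySpace {κ : ℝ} (hκ : 0 < κ) {l : ℂ} {w : ℂ × ℂ}
    (hw : w ∈ domainAbove (quad κ l)) :
    (fun z => modelSzego κ l z w) ∈ hardySpace (quad κ l) := by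
  constructor
  · intro z hz
    simp only [modelSzego_eq]
    have h0 := szegoBracket_ne_zero hκ (le_of_lt (show quad κ l z.1 < z.2.im from hz)) hw
    have hd : DifferentiableAt ℂ (fun z => szegoBracket κ l z w ^ 2) z := by
      unfold szegoBracket
      fun_prop
    exact ((hd.fun_inv (pow_ne_zero 2 h0)).const_mul _).differentiableWithinAt
  · have hm := memLp_szegoBoundary hκ hw
    refine lt_of_le_of_lt (iSup_le fun ε => ?_)
      (ENNReal.pow_lt_top (n := 2) hm.2)
    rw [← eLpNorm_two_sq]
    exact pow_le_pow_left' (eLpNorm_mono fun q =>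
      norm_slice_modelSzego_le hκ hw (le_of_lt ε.2) q) 2

/-! ### The reproducing property of the explicit Szegő kernel -/

/-- Mean value property for the derivative in the second variable along a holomorphic graph. -/
theorem circleAverage_deriv_snd {F : ℂ × ℂ → ℂ} {Ω : Set (ℂ × ℂ)} (hΩ : IsOpen Ω)
    (hF : DifferentiableOn ℂ F Ω) {γ : ℂ → ℂ} (hγ : Differentiable ℂ γ) {a : ℂ} {r : ℝ}
    (hr : 0 ≤ r) (hdom : ∀ ζ ∈ Metric.closedBall a r, (ζ, γ ζ) ∈ Ω) :
    Real.circleAverage (fun ζ => deriv (fun v => F (ζ, v)) (γ ζ)) a r =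
      deriv (fun v => F (a, v)) (γ a) := by
  have hγc : Continuous γ := hγ.continuous
  have hK : IsCompact ((fun ζ => (ζ, γ ζ)) '' Metric.closedBall a r) :=
    (isCompact_closedBall a r).image (by fun_prop)
  obtain ⟨ρ, hρ, hρΩ⟩ := hK.exists_cthickening_subset_open hΩ (by
    rintro _ ⟨ζ, hζ, rfl⟩
    exact hdom ζ hζ)
  have hin : ∀ ζ ∈ Metric.closedBall a r, ∀ v : ℂ, ‖v‖ ≤ ρ → (ζ, γ ζ + v) ∈ Ω := by
    intro ζ hζ v hv
    refine hρΩ (Metric.mem_cthickening_of_dist_le _ (ζ, γ ζ) _ _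
      (Set.mem_image_of_mem (fun ζ => (ζ, γ ζ)) hζ) ?_)
    simp [Prod.dist_eq, hv]
  set k : ℝ → ℂ := fun θ => deriv (circleMap 0 ρ) θ * (1 / circleMap 0 ρ θ ^ 2) with hk
  have hv : ∀ θ, ‖circleMap 0 ρ θ‖ ≤ ρ := fun θ => by simp [abs_of_pos hρ]
  have hkc : Continuous k := by
    simp only [hk, deriv_circleMap]
    refine (by fun_prop : Continuous fun θ => circleMap 0 ρ θ * Complex.I).mul
      (continuous_const.div (by fun_prop) fun θ => pow_ne_zero 2 ?_)
    exact circleMap_ne_center hρ.ne'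
  -- Compactness gave one radius `ρ` for all `ζ`. Writing the derivative as a Cauchy integral lets
  -- the mean value property be applied to `F` itself.
  have hcauchy : ∀ ζ ∈ Metric.closedBall a r, deriv (fun v => F (ζ, v)) (γ ζ) =
      (2 * π * Complex.I)⁻¹ *
        ∫ θ in (0)..(2 * π), k θ * F (ζ, γ ζ + circleMap 0 ρ θ) := by
    intro ζ hζ
    have h : DifferentiableOn ℂ (fun v => F (ζ, v)) (Metric.closedBall (γ ζ) ρ) := by
      refine hF.comp (by fun_prop) fun v hv => ?_
      have := hin ζ hζ (v - γ ζ) (mem_closedBall_iff_norm.1 hv)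
      simpa using this
    have h2 := DiffContOnCl.deriv_eq_smul_circleIntegral hρ
      ((h.mono Metric.closure_ball_subset_closedBall).diffContOnCl)
    have hne : (2 * π * Complex.I : ℂ) ≠ 0 := Complex.two_pi_I_ne_zero
    rw [eq_inv_mul_iff_mul_eq₀ hne, ← smul_eq_mul, ← h2, circleIntegral]
    refine intervalIntegral.integral_congr fun θ _ => ?_
    have e : circleMap (γ ζ) ρ θ = γ ζ + circleMap 0 ρ θ := by simp [circleMap]
    simp only [deriv_circleMap, hk, smul_eq_mul, e, add_sub_cancel_left]
    ring
  have hmem : ∀ φ : ℝ, circleMap a r φ ∈ Metric.closedBall a r := fun φ =>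
    circleMap_mem_closedBall a hr φ
  have hcont : Continuous (fun x : ℝ × ℝ =>
      k x.2 * F (circleMap a r x.1, γ (circleMap a r x.1) + circleMap 0 ρ x.2)) := by
    refine (hkc.comp continuous_snd).mul (hF.continuousOn.comp_continuous (by fun_prop) fun x => ?_)
    exact hin _ (hmem x.1) _ (hv x.2)
  have hswap : ∫ φ in (0)..(2 * π), (∫ θ in (0)..(2 * π),
        k θ * F (circleMap a r φ, γ (circleMap a r φ) + circleMap 0 ρ θ)) =
      ∫ θ in (0)..(2 * π), (∫ φ in (0)..(2 * π),
        k θ * F (circleMap a r φ, γ (circleMap a r φ) + circleMap 0 ρ θ)) := by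
    simp only [intervalIntegral.integral_of_le Real.two_pi_pos.le]
    refine integral_integral_swap ?_
    rw [Measure.prod_restrict]
    refine IntegrableOn.mono_set (t := Set.Icc 0 (2 * π) ×ˢ Set.Icc 0 (2 * π)) ?_
      (Set.prod_mono Set.Ioc_subset_Icc_self Set.Ioc_subset_Icc_self)
    exact hcont.continuousOn.integrableOn_compact (isCompact_Icc.prod isCompact_Icc)
  have hmean : ∀ θ : ℝ, ∫ φ in (0)..(2 * π),
      F (circleMap a r φ, γ (circleMap a r φ) + circleMap 0 ρ θ) =
        2 * π * F (a, γ a + circleMap 0 ρ θ) := by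
    intro θ
    have h := circleAverage_eq_of_differentiableOn
      (g := fun ζ => F (ζ, γ ζ + circleMap 0 ρ θ)) (U := Metric.closedBall a r) (c := a) (r := r)
      (hF.comp (by fun_prop) fun ζ hζ => hin ζ hζ _ (hv θ)) hr subset_rfl
    have hpi : (π : ℂ) ≠ 0 := by exact_mod_cast Real.pi_ne_zero
    rw [← h, Real.circleAverage, Complex.real_smul]
    push_cast
    rw [← mul_assoc, mul_inv_cancel₀ (by simp [hpi]), one_mul]
  have hpi : (π : ℂ) ≠ 0 := by exact_mod_cast Real.pi_ne_zero
  rw [Real.circleAverage, intervalIntegral.integral_congr (fun φ _ => hcauchy _ (hmem φ)),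
    intervalIntegral.integral_const_mul, hswap, hcauchy a (Metric.mem_closedBall_self hr)]
  simp only [intervalIntegral.integral_const_mul, hmean]
  simp only [mul_left_comm (k _)]
  rw [intervalIntegral.integral_const_mul, Complex.real_smul]
  push_cast
  field_simp

/-- Besides `κ‖ζ - a‖²` the expansion about `a` contains only the real part of a holomorphic
polynomial, which a holomorphic graph `ζ ↦ (ζ, γ ζ)` can follow. -/
theorem quad_eq_add (κ : ℝ) (l a ζ : ℂ) : quad κ l ζ =
    quad κ l a + κ * ‖ζ - a‖ ^ 2 + (2 * κ * conj a * (ζ - a) + l * (ζ ^ 2 - a ^ 2)).re := by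
  simp only [quad, ← Complex.normSq_eq_norm_sq, Complex.normSq_apply]
  simp [sq]
  ring

/-- The complex height at which the `t`-integral of a Hardy function against the Szegő kernel
evaluates the derivative of the function. -/
noncomputable def szegoHeight (κ : ℝ) (l a ζ : ℂ) : ℂ :=
  2 * κ * conj ζ * (ζ - a) + l * (ζ ^ 2 - a ^ 2)

theorem integral_slice_mul_conj_szegoBoundary {κ : ℝ} (hκ : 0 < κ) {l : ℂ} {w : ℂ × ℂ}
    (hw : w ∈ domainAbove (quad κ l)) {F : ℂ × ℂ → ℂ} (hF : F ∈ hardySpace (quad κ l))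
    {ε : ℝ} (hε : 0 < ε) (ζ : ℂ) :
    ∫ t : ℝ, slice (quad κ l) F ε (ζ, t) * conj (szegoBoundary κ l w (ζ, t)) =
      -(κ / π ^ 2 * (2 * π * Complex.I)) *
        deriv (fun v => F (ζ, v)) (w.2 + Complex.I * ε + Complex.I * szegoHeight κ l w.1 ζ) := by
  have hp := continuous_quad κ l
  set X : ℂ := 2 * κ * w.1 * conj ζ + (l * w.1 ^ 2 + conj l * conj ζ ^ 2) with hX
  -- The double pole in `t` of the conjugated kernel; Hermitian symmetry and positivity of the
  -- bracket place it in the upper half plane.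
  set c : ℂ := w.2 + Complex.I * (quad κ l ζ : ℂ) - Complex.I * X with hc
  have hbr : ∀ t : ℝ, szegoBracket κ l w (boundaryPoint (quad κ l) (ζ, t)) =
      Complex.I * (t - c) := by
    intro t
    simp only [szegoBracket, boundaryPoint, hc, hX, map_add, map_mul, Complex.conj_I,
      Complex.conj_ofReal]
    linear_combination -(2 * κ * w.1 * conj ζ + (l * w.1 ^ 2 + conj l * conj ζ ^ 2)) * Complex.I_sq
  have hci : 0 < c.im := by
    have h1 := szegoBracket_re_pos hκ (boundaryPoint_im (quad κ l) (ζ, 0)).ge hw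
    rw [← Complex.conj_re, conj_szegoBracket, hbr] at h1
    simpa using h1
  have hs : ∀ t : ℝ, conj (szegoBoundary κ l w (ζ, t)) =
      -(κ / π ^ 2) * (((t : ℂ) - c) ^ 2)⁻¹ := by
    intro t
    rw [szegoBoundary, conj_modelSzego, modelSzego_eq, hbr, mul_pow, Complex.I_sq, mul_inv]
    norm_num
  obtain ⟨M, hM⟩ := exists_norm_le_of_mem_hardySpace hp hF ζ hε
  have h := integral_div_sq_sub
    (f := fun z => F (ζ, z + Complex.I * quad κ l ζ + Complex.I * ε)) (M := M) hε
    (hF.1.comp (by fun_prop) fun z hz => by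
      have : -ε < z.im := hz
      simp only [domainAbove, Set.mem_ofPred_eq]
      simp; linarith) (fun z hz => hM _ (by simp; linarith)) hci
  simp only [hs, slice, mul_left_comm _ (-(κ / π ^ 2) : ℂ)]
  rw [integral_const_mul, h]
  have e : deriv (fun z => F (ζ, z + Complex.I * quad κ l ζ + Complex.I * ε)) c =
      deriv (fun v => F (ζ, v)) (c + (Complex.I * quad κ l ζ + Complex.I * ε)) := by
    simp only [add_assoc]
    exact deriv_comp_add_const (fun v => F (ζ, v)) _ c
  have e2 : c + (Complex.I * quad κ l ζ + Complex.I * ε) =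
      w.2 + Complex.I * ε + Complex.I * szegoHeight κ l w.1 ζ := by
    simp only [hc, hX, szegoHeight, ofReal_quad]
    ring
  rw [e, e2]
  ring

theorem circleAverage_deriv_szegoHeight {κ : ℝ} (hκ : 0 < κ) {l : ℂ} {w : ℂ × ℂ}
    (hw : w ∈ domainAbove (quad κ l)) {F : ℂ × ℂ → ℂ}
    (hF : DifferentiableOn ℂ F (domainAbove (quad κ l))) {ε : ℝ} (hε : 0 < ε) {r : ℝ}
    (hr : 0 ≤ r) :
    Real.circleAverage (fun ζ => deriv (fun v => F (ζ, v))
      (w.2 + Complex.I * ε + Complex.I * szegoHeight κ l w.1 ζ)) w.1 r =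
      deriv (fun v => F (w.1, v)) (w.2 + Complex.I * ε + Complex.I * (2 * κ * r ^ 2)) := by
  set γ : ℂ → ℂ := fun ζ => w.2 + Complex.I * ε + Complex.I *
    (2 * κ * r ^ 2 + (2 * κ * conj w.1 * (ζ - w.1) + l * (ζ ^ 2 - w.1 ^ 2))) with hγ
  have hγa : γ w.1 = w.2 + Complex.I * ε + Complex.I * (2 * κ * r ^ 2) := by simp [hγ]
  have h := circleAverage_deriv_snd (isOpen_domainAbove (continuous_quad κ l)) hF (γ := γ)
    (a := w.1) (by fun_prop) hr (fun ζ hζ => by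
      have h0 : quad κ l w.1 < w.2.im := hw
      have h1 := quad_eq_add κ l w.1 ζ
      have h2 : ‖ζ - w.1‖ ^ 2 ≤ r ^ 2 := by
        have := mem_closedBall_iff_norm.1 hζ
        gcongr
      have h3 : (γ ζ).im = w.2.im + ε + 2 * κ * r ^ 2 +
          (2 * κ * conj w.1 * (ζ - w.1) + l * (ζ ^ 2 - w.1 ^ 2)).re := by
        simp only [hγ, Complex.add_im, Complex.I_mul_im, Complex.ofReal_re, Complex.add_re]
        have : (2 * κ * r ^ 2 : ℂ) = ((2 * κ * r ^ 2 : ℝ) : ℂ) := by push_cast; rfl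
        rw [this, Complex.ofReal_re]
        ring
      simp only [domainAbove, Set.mem_ofPred_eq]
      nlinarith [mul_le_mul_of_nonneg_left h2 hκ.le, sq_nonneg r, mul_nonneg hκ.le (sq_nonneg r)])
  rw [← hγa, ← h]
  refine Real.circleAverage_congr_sphere fun ζ hζ => ?_
  rw [abs_of_nonneg hr, mem_sphere_iff_norm] at hζ
  have h1 : (ζ - w.1) * conj (ζ - w.1) = (r : ℂ) ^ 2 := by
    rw [Complex.mul_conj, Complex.normSq_eq_norm_sq, hζ]; norm_cast
  congr 1
  simp only [hγ, szegoHeight]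
  rw [map_sub] at h1
  linear_combination Complex.I * 2 * κ * h1

theorem integral_slice_mul_conj_szegoBoundary_eq {κ : ℝ} (hκ : 0 < κ) {l : ℂ} {w : ℂ × ℂ}
    (hw : w ∈ domainAbove (quad κ l)) {F : ℂ × ℂ → ℂ} (hF : F ∈ hardySpace (quad κ l))
    {ε : ℝ} (hε : 0 < ε) :
    ∫ q, slice (quad κ l) F ε q * conj (szegoBoundary κ l w q) =
      F (w.1, w.2 + Complex.I * ε) := by
  have hp := continuous_quad κ l
  have hw0 : quad κ l w.1 < w.2.im := hw
  have hκ' : (κ : ℂ) ≠ 0 := by exact_mod_cast hκ.ne'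
  have hpi : (π : ℂ) ≠ 0 := by exact_mod_cast Real.pi_ne_zero
  have hint : Integrable (fun q => slice (quad κ l) F ε q * conj (szegoBoundary κ l w q))
      (volume.prod volume) :=
    (memLp_slice hp hF hε).integrable_mul (memLp_szegoBoundary hκ hw).star
  have hleft := hint.integral_prod_left
  rw [Measure.volume_eq_prod, integral_prod _ hint]
  simp only [integral_slice_mul_conj_szegoBoundary hκ hw hF hε] at hleft ⊢
  set D : ℂ → ℂ := fun ζ => deriv (fun v => F (ζ, v))
    (w.2 + Complex.I * ε + Complex.I * szegoHeight κ l w.1 ζ) with hD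
  set k : ℂ := -(κ / π ^ 2 * (2 * π * Complex.I)) with hk
  have hk0 : k ≠ 0 := by
    rw [hk]
    simp [hκ', hpi]
  -- Integrability of `D` comes from Fubini, up to the nonzero factor `k`.
  have hDi : Integrable D := (integrable_const_mul_iff (IsUnit.mk0 k hk0) D).1 hleft
  obtain ⟨hrad, hval⟩ := integral_eq_integral_circleAverage hDi w.1
  set V : ℝ → ℂ := fun r => w.2 + Complex.I * ε + Complex.I * (2 * κ * r ^ 2) with hV
  have hVim : ∀ r : ℝ, (V r).im = w.2.im + ε + 2 * κ * r ^ 2 := by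
    intro r
    simp only [hV, Complex.add_im, Complex.I_mul_im, Complex.ofReal_re]
    have : (2 * κ * r ^ 2 : ℂ) = ((2 * κ * r ^ 2 : ℝ) : ℂ) := by push_cast; rfl
    rw [this, Complex.ofReal_re]
  have hca : ∀ r ∈ Set.Ioi (0 : ℝ), (r : ℂ) * Real.circleAverage D w.1 r =
      r * deriv (fun v => F (w.1, v)) (V r) := fun r hr => by
    rw [hD, circleAverage_deriv_szegoHeight hκ hw hF.1 hε (le_of_lt hr)]
  have hdom : ∀ r : ℝ, (w.1, V r) ∈ domainAbove (quad κ l) := by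
    intro r
    simp only [domainAbove, Set.mem_ofPred_eq, hVim]
    have : 0 ≤ 2 * κ * r ^ 2 := by positivity
    linarith
  -- Since `V' = 4iκr`, the polar Jacobian `r` is exactly what makes the radial integrand a total
  -- derivative.
  have hderiv : ∀ r : ℝ, HasDerivAt (fun r => F (w.1, V r))
      (4 * κ * Complex.I * (r * deriv (fun v => F (w.1, v)) (V r))) r := by
    intro r
    have h1 : DifferentiableAt ℂ (fun v => F (w.1, v)) (V r) := by
      have := hF.1.differentiableAt ((isOpen_domainAbove hp).mem_nhds (hdom r))
      exact this.comp (V r) (by fun_prop)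
    have h2 : HasDerivAt V (Complex.I * (2 * κ * (2 * r))) r := by
      have h3 : HasDerivAt (fun r : ℝ => (r : ℂ) ^ 2) (2 * r) r := by
        simpa using (hasDerivAt_pow 2 (r : ℂ)).comp_ofReal
      exact ((h3.const_mul (2 * κ : ℂ)).const_mul Complex.I).const_add _
    refine (h1.hasDerivAt.scomp r h2).congr_deriv ?_
    rw [smul_eq_mul]
    ring
  have hint2 : IntegrableOn (fun r : ℝ => 4 * κ * Complex.I *
      (r * deriv (fun v => F (w.1, v)) (V r))) (Set.Ioi 0) :=
    (hrad.congr_fun hca measurableSet_Ioi).const_mul _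
  have htend : Tendsto (fun r : ℝ => F (w.1, V r)) atTop (𝓝 0) := by
    refine tendsto_zero_of_mem_hardySpace hp hF w.1 ?_
    simp only [hVim]
    exact tendsto_atTop_add_const_left _ _
      ((tendsto_pow_atTop two_ne_zero).const_mul_atTop (by positivity))
  have hftc := integral_Ioi_of_hasDerivAt_of_tendsto (hderiv 0).continuousAt.continuousWithinAt
    (fun r _ => hderiv r) hint2 htend
  rw [integral_const_mul] at hftc
  rw [integral_const_mul, hval, setIntegral_congr_fun measurableSet_Ioi hca]
  have hV0 : V 0 = w.2 + Complex.I * ε := by simp [hV]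
  rw [hV0, zero_sub] at hftc
  rw [← neg_eq_iff_eq_neg.2 hftc, hk]
  field_simp
  norm_num
  ring

theorem eq_integral_isBoundaryValue_mul_conj {κ : ℝ} (hκ : 0 < κ) {l : ℂ} {w : ℂ × ℂ}
    (hw : w ∈ domainAbove (quad κ l)) {F : ℂ × ℂ → ℂ} (hF : F ∈ hardySpace (quad κ l))
    {f : ℂ × ℝ → ℂ} (hf : IsBoundaryValue (quad κ l) F f) :
    F w = ∫ q, f q * conj (szegoBoundary κ l w q) := by
  have hp := continuous_quad κ l
  have hs := (memLp_szegoBoundary hκ hw).star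
  have h1 : Tendsto (fun ε : ℝ => F (w.1, w.2 + Complex.I * ε)) (𝓝[>] 0) (𝓝 (F w)) := by
    have hc : ContinuousAt F (w.1, w.2 + Complex.I * (0 : ℝ)) := by
      simpa using hF.1.continuousOn.continuousAt ((isOpen_domainAbove hp).mem_nhds hw)
    have h2 : ContinuousAt (fun ε : ℝ => F (w.1, w.2 + Complex.I * ε)) 0 :=
      ContinuousAt.comp (f := fun ε : ℝ => (w.1, w.2 + Complex.I * (ε : ℂ))) hc (by fun_prop)
    have h3 := h2.tendsto.mono_left (nhdsWithin_le_nhds (s := Set.Ioi 0))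
    simpa using h3
  have h2 : Tendsto (fun ε : ℝ => ∫ q, slice (quad κ l) F ε q * conj (szegoBoundary κ l w q))
      (𝓝[>] 0) (𝓝 (∫ q, f q * conj (szegoBoundary κ l w q))) := by
    refine tendsto_integral_of_L1' _ (hf.1.integrable_mul hs).aestronglyMeasurable ?_ ?_
    · filter_upwards [self_mem_nhdsWithin] with ε hε
      exact (memLp_slice hp hF hε).integrable_mul hs
    · have hlim := ENNReal.Tendsto.mul_const hf.2
        (b := eLpNorm (star (szegoBoundary κ l w)) 2 volume) (Or.inr hs.2.ne)
      rw [zero_mul] at hlim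
      refine tendsto_of_tendsto_of_tendsto_of_le_of_le' tendsto_const_nhds hlim
        (Eventually.of_forall fun _ => bot_le) ?_
      filter_upwards [self_mem_nhdsWithin] with ε hε
      -- Cauchy–Schwarz: `L²` convergence of the slices gives `L¹` convergence after multiplication
      -- by the kernel.
      have h := eLpNorm_smul_le_mul_eLpNorm (p := 2) (q := 2) (r := 1) hs.1
        ((memLp_slice hp hF hε).1.sub hf.1.1)
      refine le_trans (le_of_eq ?_) h
      congr 1
      ext q
      simp [sub_mul]
  refine tendsto_nhds_unique h1 (h2.congr' ?_)
  filter_upwards [self_mem_nhdsWithin] with ε hε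
  exact integral_slice_mul_conj_szegoBoundary_eq hκ hw hF hε

theorem isSzegoKernel_modelSzego {κ : ℝ} (hκ : 0 < κ) (l : ℂ) :
    IsSzegoKernel (quad κ l) (modelSzego κ l) := by
  refine fun w hw => ⟨modelSzego_mem_hardySpace hκ hw, szegoBoundary κ l w,
    isBoundaryValue_szegoBoundary hκ hw, fun F hF => ?_⟩
  obtain ⟨f, hf⟩ := exists_isBoundaryValue (continuous_quad κ l) hF
  exact ⟨f, hf, eq_integral_isBoundaryValue_mul_conj hκ hw hF hf⟩

/-- Uniqueness of the Szegő kernel, given one with Hermitian symmetry. -/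
theorem IsSzegoKernel.eq {p : ℂ → ℝ} (hp : Continuous p) {S S' : ℂ × ℂ → ℂ × ℂ → ℂ}
    (hS : IsSzegoKernel p S) (hS' : IsSzegoKernel p S') (hsymm : ∀ z w, conj (S' z w) = S' w z)
    {z w : ℂ × ℂ} (hz : z ∈ domainAbove p) (hw : w ∈ domainAbove p) : S z w = S' z w := by
  obtain ⟨hmem, s, hs, hrep⟩ := hS w hw
  obtain ⟨hmem', s', hs', hrep'⟩ := hS' z hz
  obtain ⟨f, hf, hfz⟩ := hrep' _ hmem
  obtain ⟨g, hg, hgw⟩ := hrep _ hmem'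
  rw [hfz, ← hsymm w z, hgw, ← integral_conj]
  refine integral_congr_ae ?_
  filter_upwards [hf.ae_eq hp hmem hs, hg.ae_eq hp hmem' hs'] with q h1 h2
  rw [h1, h2, map_mul, Complex.conj_conj, mul_comm]

/-! ### The Szegő kernel as an integral of Bergman kernels -/

theorem integral_mul_cexp_neg_mul {c : ℂ} (hc : 0 < c.re) :
    IntegrableOn (fun τ : ℝ => (τ : ℂ) * Complex.exp (-c * τ)) (Set.Ioi 0) ∧
    ∫ τ in Set.Ioi (0 : ℝ), (τ : ℂ) * Complex.exp (-c * τ) = (c ^ 2)⁻¹ := by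
  have hint : IntegrableOn (fun τ : ℝ => (τ : ℂ) * Complex.exp (-c * τ)) (Set.Ioi 0) := by
    have h := integrableOn_rpow_mul_exp_neg_mul_rpow (s := 1) (p := 1) (by norm_num) (by norm_num) hc
    refine h.mono' (by fun_prop) ?_
    filter_upwards [ae_restrict_mem measurableSet_Ioi] with τ hτ
    have hτ0 : 0 < τ := hτ
    simp [Complex.norm_exp, abs_of_pos hτ0]
  refine ⟨hint, ?_⟩
  have hc0 : c ≠ 0 := fun h => by simp [h] at hc
  -- The primitive from integration by parts; it vanishes at infinity and equals `-1 / c²` at zero.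
  have hderiv : ∀ τ : ℝ, HasDerivAt
      (fun τ : ℝ => -((τ : ℂ) * Complex.exp (-c * τ)) / c - Complex.exp (-c * τ) / c ^ 2)
      ((τ : ℂ) * Complex.exp (-c * τ)) τ := by
    intro τ
    have h0 : HasDerivAt (fun τ : ℝ => (τ : ℂ)) 1 τ := Complex.ofRealCLM.hasDerivAt
    have h1 : HasDerivAt (fun τ : ℝ => Complex.exp (-c * τ)) (Complex.exp (-c * τ) * (-c * 1)) τ :=
      (h0.const_mul (-c)).cexp
    refine (((h0.fun_mul h1).fun_neg.div_const c).fun_sub (h1.div_const (c ^ 2))).congr_deriv ?_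
    field_simp
    ring
  have htend : ∀ n : ℕ, Tendsto (fun τ : ℝ => (τ : ℂ) ^ n * Complex.exp (-c * τ)) atTop (𝓝 0) := by
    intro n
    rw [tendsto_zero_iff_norm_tendsto_zero]
    refine (tendsto_rpow_mul_exp_neg_mul_atTop_nhds_zero n c.re hc).congr' ?_
    filter_upwards [eventually_gt_atTop 0] with τ hτ
    simp [Complex.norm_exp, abs_of_pos hτ]
  have h0 := htend 0
  have h1 := htend 1
  simp only [pow_zero, pow_one, one_mul] at h0 h1
  have hlim := (h1.neg.div_const c).sub (h0.div_const (c ^ 2))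
  rw [integral_Ioi_of_hasDerivAt_of_tendsto (hderiv 0).continuousAt.continuousWithinAt
    (fun τ _ => hderiv τ) hint hlim]
  simp

theorem modelBergman_mul_cexp (κ : ℝ) (l : ℂ) (z w : ℂ × ℂ) (τ : ℝ) :
    modelBergman κ l τ z.1 w.1 * Complex.exp (-2 * π * Complex.I * τ * (conj w.2 - z.2)) =
      4 * κ * (τ * Complex.exp (-(2 * π * szegoBracket κ l z w) * τ)) := by
  rw [modelBergman, mul_assoc, ← Complex.exp_add, szegoBracket]
  ring_nf

theorem modelSzego_eq_integral {κ : ℝ} (hκ : 0 < κ) {l : ℂ} {z w : ℂ × ℂ}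
    (hz : z ∈ domainAbove (quad κ l)) (hw : w ∈ domainAbove (quad κ l)) :
    IntegrableOn (fun τ : ℝ => modelBergman κ l τ z.1 w.1 *
      Complex.exp (-2 * π * Complex.I * τ * (conj w.2 - z.2))) (Set.Ioi 0) ∧
    modelSzego κ l z w = ∫ τ in Set.Ioi (0 : ℝ), modelBergman κ l τ z.1 w.1 *
      Complex.exp (-2 * π * Complex.I * τ * (conj w.2 - z.2)) := by
  have hre := szegoBracket_re_pos hκ (le_of_lt (show quad κ l z.1 < z.2.im from hz)) hw
  have hc : 0 < (2 * π * szegoBracket κ l z w).re := by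
    rw [show (2 * π : ℂ) = ((2 * π : ℝ) : ℂ) by push_cast; rfl, Complex.re_ofReal_mul]
    positivity
  obtain ⟨h1, h2⟩ := integral_mul_cexp_neg_mul hc
  simp only [modelBergman_mul_cexp]
  refine ⟨h1.const_mul _, ?_⟩
  rw [integral_const_mul, h2, modelSzego_eq]
  have hpi : (π : ℂ) ≠ 0 := by exact_mod_cast Real.pi_ne_zero
  have hb : szegoBracket κ l z w ≠ 0 := fun h => by simp [h] at hre
  field_simp
  norm_num

end SzegoBergman

/-! ### Transfer of the explicit formulas to arbitrary kernels by uniqueness. -/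

theorem mainTheorem5 (κ : ℝ) (hκ : 0 < κ) (l : ℂ) :
    (∃ K : ℝ → ℂ → ℂ → ℂ, ∀ τ : ℝ, 0 < τ →
      SzegoBergman.IsBergmanKernel (SzegoBergman.modelWeight τ κ l) (K τ)) ∧
    (∃ S : ℂ × ℂ → ℂ × ℂ → ℂ, SzegoBergman.IsSzegoKernel (SzegoBergman.quad κ l) S) ∧
    ∀ K : ℝ → ℂ → ℂ → ℂ,
      (∀ τ : ℝ, 0 < τ → SzegoBergman.IsBergmanKernel (SzegoBergman.modelWeight τ κ l) (K τ)) →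
    ∀ S : ℂ × ℂ → ℂ × ℂ → ℂ, SzegoBergman.IsSzegoKernel (SzegoBergman.quad κ l) S →
      (∀ τ : ℝ, 0 < τ → ∀ z w : ℂ,
        K τ z w = 4 * τ * κ * Complex.exp
          (2 * π * τ * (l * z ^ 2 + conj l * conj w ^ 2) + 4 * π * τ * κ * z * conj w)) ∧
      ∀ z ∈ SzegoBergman.modelDomain κ l, ∀ w ∈ SzegoBergman.modelDomain κ l,
        IntegrableOn (fun τ : ℝ => K τ z.1 w.1 *
          Complex.exp (-2 * π * Complex.I * τ * (conj w.2 - z.2))) (Set.Ioi 0) volume ∧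
        S z w = ∫ τ in Set.Ioi (0 : ℝ), K τ z.1 w.1 *
          Complex.exp (-2 * π * Complex.I * τ * (conj w.2 - z.2)) ∧
        S z w = κ / π ^ 2 * (Complex.I * (conj w.2 - z.2) - 2 * κ * z.1 * conj w.1
          - (l * z.1 ^ 2 + conj l * conj w.1 ^ 2)) ^ (-2 : ℤ) := by
  refine ⟨⟨SzegoBergman.modelBergman κ l, fun τ hτ =>
    SzegoBergman.isBergmanKernel_modelBergman hκ l hτ⟩, ⟨SzegoBergman.modelSzego κ l,
    SzegoBergman.isSzegoKernel_modelSzego hκ l⟩, fun K hK S hS => ?_⟩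
  have hKeq : ∀ τ : ℝ, 0 < τ → ∀ z w : ℂ, K τ z w = SzegoBergman.modelBergman κ l τ z w :=
    fun τ hτ z w => (hK τ hτ).eq (SzegoBergman.isBergmanKernel_modelBergman hκ l hτ)
      (SzegoBergman.conj_modelBergman κ l τ) z w
  refine ⟨hKeq, fun z hz w hw => ?_⟩
  have hSeq : S z w = SzegoBergman.modelSzego κ l z w :=
    hS.eq (SzegoBergman.continuous_quad κ l) (SzegoBergman.isSzegoKernel_modelSzego hκ l)
      (SzegoBergman.conj_modelSzego κ l) hz hw
  obtain ⟨h1, h2⟩ := SzegoBergman.modelSzego_eq_integral hκ hz hw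
  have hcongr : ∀ τ ∈ Set.Ioi (0 : ℝ), SzegoBergman.modelBergman κ l τ z.1 w.1 *
      Complex.exp (-2 * π * Complex.I * τ * (conj w.2 - z.2)) =
      K τ z.1 w.1 * Complex.exp (-2 * π * Complex.I * τ * (conj w.2 - z.2)) := fun τ hτ => by
    rw [hKeq τ hτ]
  refine ⟨h1.congr_fun hcongr measurableSet_Ioi, ?_, hSeq⟩
  rw [hSeq, h2]
  exact setIntegral_congr_fun measurableSet_Ioi hcongr
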